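/- For $e\in[0,1)$ let $u(t,e)$ be the solution of Kepler's equation $u-e\sin u=t$, let $r(t,e)=\frac12(1-e\cos u(t,e))$, and consider the elliptic Sitnikov problem $$\ddot x+F(x,t,e)=0,\qquad F(x,t,e)=\frac{x}{(x^2+r(t,e)^2)^{3/2}}.$$ Let $X(t,\eta,e)$ denote its solution with $x(0)=0$, $\dot x(0)=\eta$. Let $m,p\ge 1$ be integers with $1\le p\le[\sqrt8\,m]$. A family of odd $(m,p)$-periodic solutions is a family $\phi_{m,p}(t,e)=X(t,E(e),e)$, $0\le e<\varepsilon$, where $0<\varepsilon\le1$, $E:[0,\varepsilon)\to\mathbb R$ is smooth ($C^\infty$), $X(m\pi,E(e),e)=0$ for all $e\in[0,\varepsilon)$, $E(0)>0$, and $\phi_{m,p}(\cdot,0)$ has minimal period $2\pi m/p$. Let $\tau_{m,p}(e)=\psi_1(2m\pi,e)+\dot\psi_2(2m\pi,e)$ be the trace of the $2m\pi$-periodic Poincaré matrix of the linearized equation $$\ddot y+\frac{\partial F}{\partial x}(\phi_{m,p}(t,e),t,e)\,y=0,$$ where $\psi_1,\psi_2$ are its solutions with $(\psi_1,\dot\psi_1)(0,e)=(1,0)$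 and $(\psi_2,\dot\psi_2)(0,e)=(0,1)$. **Theorem.** Such a family and its trace exist. If $$\frac pm\notin\Big\{\frac12,\frac14,\frac16,\dots\Big\},$$ then for every such family $\tau_{m,p}$ is differentiable (from the right) at $e=0$ and $\tau_{m,p}'(0)=0$. In particular, $\tau'_{m,p}(0)=0$ whenever $m$ is odd, and whenever $m$ is even and $p\ge m/2+1$. -/

import Mathlib

open Set
open scoped ContDiff

namespace Sitnikov

noncomputable section

/-- The Kepler function `u(t, e)`: the solution `u` of Kepler's equation `u - e sin u = t`
(unique for `0 ≤ e < 1`, see the two lemmas that follow). -/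
def kepler (t e : ℝ) : ℝ := Function.invFun (fun u : ℝ => u - e * Real.sin u) t

theorem kepler_strictMono {e : ℝ} (h0 : 0 ≤ e) (h1 : e < 1) :
    StrictMono (fun u : ℝ => u - e * Real.sin u) := by
  apply strictMono_of_deriv_pos
  intro x
  have h : HasDerivAt (fun u : ℝ => u - e * Real.sin u) (1 - e * Real.cos x) x :=
    (hasDerivAt_id x).sub ((Real.hasDerivAt_sin x).const_mul e)
  rw [h.deriv]
  nlinarith [Real.cos_le_one x]

theorem kepler_spec {e : ℝ} (h0 : 0 ≤ e) (h1 : e < 1) (t : ℝ) :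
    kepler t e - e * Real.sin (kepler t e) = t := by
  have hs : ∃ u : ℝ, (fun u : ℝ => u - e * Real.sin u) u = t := by
    have hc : ContinuousOn (fun u : ℝ => u - e * Real.sin u) (Icc (t - 1) (t + 1)) := by
      fun_prop
    have hi := intermediate_value_Icc (by linarith : t - 1 ≤ t + 1) hc
    obtain ⟨u, -, hu⟩ := hi (show t ∈ _ by
      constructor
      · nlinarith [Real.neg_one_le_sin (t - 1)]
      · nlinarith [Real.sin_le_one (t + 1)])
    exact ⟨u, hu⟩
  exact Function.invFun_eq hs

/-- Half the distance of the primaries, `r(t, e) = r₀ (1 - e cos u(t, e))` with `r₀ = 1/2`. -/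
def r (t e : ℝ) : ℝ := 1 / 2 * (1 - e * Real.cos (kepler t e))

/-- The Sitnikov force `F(x, t, e) = x / (x² + r(t, e)²)^{3/2}`. -/
def F (x t e : ℝ) : ℝ := x / (x ^ 2 + r t e ^ 2) ^ (3 / 2 : ℝ)

/-- `x` is the (global, twice differentiable) solution of the initial value problem
`x'' + g(x, t) = 0`, `x(0) = a`, `x'(0) = v`. -/
structure IsSolutionIVP (g : ℝ → ℝ → ℝ) (a v : ℝ) (x : ℝ → ℝ) : Prop where
  differentiable : Differentiable ℝ x
  equation : ∀ t, HasDerivAt (deriv x) (-g (x t) t) t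
  init_pos : x 0 = a
  init_vel : deriv x 0 = v

/-- `T` is the minimal period of the (nonconstant) function `x`. -/
def IsMinimalPeriod (x : ℝ → ℝ) (T : ℝ) : Prop :=
  IsLeast {s : ℝ | 0 < s ∧ Function.Periodic x s} T

/-- The family `φ(t, e)`, `0 ≤ e < ε`, of odd `(m, p)`-periodic solutions of the Sitnikov problem
that emanates from the odd solution of minimal period `2πm/p` of the circular problem. With
`X(t, η, e)` the solution of `x'' + F(x, t, e) = 0`, `x(0) = 0`, `x'(0) = η`, one has
`φ(t, e) = X(t, E(e), e)`, where `E` is a smooth function on `[0, ε)` such that `E(0) > 0` is the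
initial velocity of that odd solution and `X(mπ, E(e), e) = 0`.
(The symmetries of `F` then make `φ(·, e)` odd and `mπ`-antiperiodic.) -/
structure IsOddFamily (m p : ℕ) (ε : ℝ) (E : ℝ → ℝ) (φ : ℝ → ℝ → ℝ) : Prop where
  eps_pos : 0 < ε
  eps_le_one : ε ≤ 1
  smooth : ContDiffOn ℝ ∞ E (Ico 0 ε)
  solution : ∀ e ∈ Ico 0 ε, IsSolutionIVP (fun x t => F x t e) 0 (E e) (fun t => φ t e)
  boundary : ∀ e ∈ Ico 0 ε, φ (m * Real.pi) e = 0
  velocity_pos : 0 < E 0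
  minimal_period : IsMinimalPeriod (fun t => φ t 0) (2 * m * Real.pi / p)

/-- `τ` is the trace `ψ₁(T) + ψ₂'(T)` of the `T`-periodic Poincaré matrix of Hill's equation
`y'' + q(t) y = 0`, where `ψ₁`, `ψ₂` are its fundamental solutions. -/
def IsHillTrace (q : ℝ → ℝ) (T τ : ℝ) : Prop :=
  ∃ ψ₁ ψ₂ : ℝ → ℝ,
    IsSolutionIVP (fun y t => q t * y) 1 0 ψ₁ ∧
    IsSolutionIVP (fun y t => q t * y) 0 1 ψ₂ ∧
    τ = ψ₁ T + deriv ψ₂ T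

/-- The potential `q(t, e) = ∂F/∂x (φ(t, e), t, e)` of the linearization along `φ(·, e)`. -/
def potential (φ : ℝ → ℝ → ℝ) (e t : ℝ) : ℝ := deriv (fun x => F x t e) (φ t e)

/-- `τ(e)`, `0 ≤ e < ε`, is the trace of the `2mπ`-periodic Poincaré matrix of the linearization
of the Sitnikov problem along `φ(·, e)`. -/
def IsTraceAlong (m : ℕ) (ε : ℝ) (φ : ℝ → ℝ → ℝ) (τ : ℝ → ℝ) : Prop :=
  ∀ e ∈ Ico 0 ε, IsHillTrace (potential φ e) (2 * m * Real.pi) (τ e)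

/-- `τ'_{m,p}(0) = 0`: the trace along the odd `(m, p)`-periodic solutions is differentiable (from
the right, the eccentricity being nonnegative) at `e = 0`, and its derivative there is `0`. -/
def TraceDerivVanishes (m p : ℕ) : Prop :=
  ∀ (ε : ℝ) (E : ℝ → ℝ) (φ : ℝ → ℝ → ℝ) (τ : ℝ → ℝ),
    IsOddFamily m p ε E φ → IsTraceAlong m ε φ τ → HasDerivWithinAt τ 0 (Ici 0) 0

end

end Sitnikov

namespace Sitnikov

noncomputable section

/-! ### Global solutions of Lipschitz differential equations -/

/-! Write T = 2mπ, P = mπ/p, x = φ(·, 0) and w = (x² + 1/4)^{-1/2}. For e = 0 the equation is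
autonomous, so the velocity x' solves the linearization and ψ₁ = x'/E(0). Hence the Poincaré matrix
at e = 0 is unipotent and upper triangular, and τ(0) = 2. Lagrange's identity (`trace_sub_two`)
expresses τ(e) - 2 by integrals of the increment of the potential q against products of perturbed
and unperturbed solutions. All these families are Lipschitz in e at 0 (`LipAtZero`), so up to O(e²)
the perturbed solutions may be replaced by the unperturbed ones. An antisymmetric part then cancels,
and a multiple of ∫ (q(t, e) - q(t, 0)) x'(t)² dt remains.

That integral is estimated without differentiating the family in e (`integral_potential_sub_le`).
The velocity φ'(·, e) solves the linearization with the forcing ∂F/∂t = O(e). Lagrange's identity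
between φ'(·, 0) and φ'(·, e) has no boundary terms, because the acceleration vanishes where φ does.
The integral is therefore, up to O(e²), a multiple of e ∫ sin t · x w⁵ x' dt, and by parts of e ∫
cos t · w³ dt. As x is P-antiperiodic, w has period P, and this integral is zero unless P is a
multiple of 2π, that is, unless p/m = 1/(2n). Otherwise τ(e) - 2 = O(e²).

For the existence of a family, shooting in the initial velocity, between slow solutions that turn
back too early and the escape velocity 2, yields a circular solution of quarter period mπ/(2p)
(`exists_quarter_solution`). Sturm comparison of its linearization with x itself gives ψ₂(mπ) ≠ 0
(`linearized_ne_zero`), so the condition X(mπ) = 0 is nondegenerate. The implicit function theorem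
in a space of continuous functions then provides E (`exists_smooth_velocity`). With the eccentric
anomaly as time and the inverse distance as an extra unknown, the equation is polynomial, hence
smooth. -/

theorem norm_integral_le_exp_abs {E : Type*} [NormedAddCommGroup E] [NormedSpace ℝ E]
    {h : ℝ → E} {K D : ℝ} (hK : 0 < K) (hh : ∀ s, ‖h s‖ ≤ D * Real.exp (K * |s|)) (t : ℝ) :
    ‖∫ s in (0 : ℝ)..t, h s‖ ≤ D / K * Real.exp (K * |t|) := by
  have hD : 0 ≤ D := by simpa using (norm_nonneg _).trans (hh 0)
  have key : ∀ f : ℝ → E, (∀ s, ‖f s‖ ≤ D * Real.exp (K * |s|)) → ∀ t : ℝ, 0 ≤ t →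
      ‖∫ s in (0 : ℝ)..t, f s‖ ≤ D / K * Real.exp (K * t) := by
    intro f hf t ht
    have h1 : ‖∫ s in (0 : ℝ)..t, f s‖ ≤ ∫ s in (0 : ℝ)..t, D * Real.exp (K * s) := by
      refine intervalIntegral.norm_integral_le_of_norm_le ht ?_
        (Continuous.intervalIntegrable (by fun_prop) _ _)
      refine Filter.Eventually.of_forall fun s hs => ?_
      have := hf s
      rwa [abs_of_pos hs.1] at this
    have h2 : ∫ s in (0 : ℝ)..t, D * Real.exp (K * s)
        = D / K * Real.exp (K * t) - D / K * Real.exp (K * 0) := by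
      refine intervalIntegral.integral_eq_sub_of_hasDerivAt (f := fun s => D / K * Real.exp (K * s))
        (fun s _ => ?_) (Continuous.intervalIntegrable (by fun_prop) _ _)
      have := (((hasDerivAt_id s).const_mul K).exp).const_mul (D / K)
      convert! this using 1
      simp only [id]
      field_simp
    have h3 : 0 ≤ D / K * Real.exp (K * 0) := by positivity
    linarith
  rcases le_total 0 t with ht | ht
  · rw [abs_of_nonneg ht]
    exact key h hh t ht
  · have h1 := key (fun s => h (-s)) (fun s => by simpa using hh (-s)) (-t) (by linarith)
    rw [intervalIntegral.integral_comp_neg, neg_neg, neg_zero,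
      intervalIntegral.integral_symm, norm_neg] at h1
    rwa [abs_of_nonpos ht]

/-- Picard iteration on the whole line with Bielecki's weight: for x(t) = exp(2K|t|) b(t) with b
bounded, `norm_integral_le_exp_abs` makes the integral operator contract by K/(2K) = 1/2, so no
local solutions have to be continued. -/
theorem exists_global_solution {E : Type*} [NormedAddCommGroup E] [NormedSpace ℝ E]
    [CompleteSpace E] {g : ℝ → E → E} {K C : ℝ} (hK : 0 < K)
    (hc : Continuous (Function.uncurry g)) (hL : ∀ t x y, ‖g t x - g t y‖ ≤ K * ‖x - y‖)
    (hC : ∀ t, ‖g t 0‖ ≤ C) (x₀ : E) :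
    ∃ x : ℝ → E, x 0 = x₀ ∧ ∀ t, HasDerivAt x (g t (x t)) t := by
  have hC0 : 0 ≤ C := (norm_nonneg _).trans (hC 0)
  have hK2 : 0 < 2 * K := by positivity
  have hcont : ∀ b : ℝ → E, Continuous b →
      Continuous fun s => g s (Real.exp (2 * K * |s|) • b s) := fun b hb =>
    hc.comp (continuous_id.prodMk (by fun_prop : Continuous fun s => Real.exp (2 * K * |s|) • b s))
  have hprim : ∀ b : ℝ → E, Continuous b → Continuous fun t =>
      Real.exp (-(2 * K * |t|)) • (x₀ + ∫ s in (0 : ℝ)..t, g s (Real.exp (2 * K * |s|) • b s)) := by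
    intro b hb
    have : Continuous fun t => ∫ s in (0 : ℝ)..t, g s (Real.exp (2 * K * |s|) • b s) :=
      intervalIntegral.continuous_primitive (fun _ _ => (hcont b hb).intervalIntegrable _ _) 0
    fun_prop
  have hbound : ∀ b : BoundedContinuousFunction ℝ E, ∀ t,
      ‖Real.exp (-(2 * K * |t|)) •
        (x₀ + ∫ s in (0 : ℝ)..t, g s (Real.exp (2 * K * |s|) • b s))‖
        ≤ ‖x₀‖ + (C + K * ‖b‖) / (2 * K) := by
    intro b t
    have h1 := norm_integral_le_exp_abs (h := fun s => g s (Real.exp (2 * K * |s|) • b s))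
      (D := C + K * ‖b‖) hK2 (fun s => by
        have e1 : 1 ≤ Real.exp (2 * K * |s|) := Real.one_le_exp (by positivity)
        have e2 := hL s (Real.exp (2 * K * |s|) • b s) 0
        rw [sub_zero, norm_smul, Real.norm_of_nonneg (Real.exp_nonneg _)] at e2
        have e3 := norm_le_norm_add_norm_sub (g s 0) (g s (Real.exp (2 * K * |s|) • b s))
        have e4 := b.norm_coe_le_norm s
        have e5 : K * (Real.exp (2 * K * |s|) * ‖b s‖) ≤ K * (Real.exp (2 * K * |s|) * ‖b‖) := by
          gcongr
        rw [norm_sub_rev] at e3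
        have e6 : C * 1 ≤ C * Real.exp (2 * K * |s|) := by gcongr
        linarith [hC s]) t
    rw [norm_smul, Real.norm_of_nonneg (Real.exp_nonneg _), Real.exp_neg]
    have e1 : 1 ≤ Real.exp (2 * K * |t|) := Real.one_le_exp (by positivity)
    rw [inv_mul_le_iff₀ (by positivity)]
    refine (norm_add_le _ _).trans ?_
    have := norm_nonneg x₀
    nlinarith
  let T : BoundedContinuousFunction ℝ E → BoundedContinuousFunction ℝ E := fun b =>
    BoundedContinuousFunction.ofNormedAddCommGroup _ (hprim b b.continuous) _ (hbound b)
  have hT : ContractingWith (1 / 2) T := by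
    refine ⟨by rw [← NNReal.coe_lt_coe]; norm_num, LipschitzWith.of_dist_le_mul fun b₁ b₂ => ?_⟩
    rw [BoundedContinuousFunction.dist_le (by positivity)]
    intro t
    have h1 := norm_integral_le_exp_abs
      (h := fun s => g s (Real.exp (2 * K * |s|) • b₁ s) - g s (Real.exp (2 * K * |s|) • b₂ s))
      (D := K * dist b₁ b₂) hK2 (fun s => by
        have e2 := hL s (Real.exp (2 * K * |s|) • b₁ s) (Real.exp (2 * K * |s|) • b₂ s)
        rw [← smul_sub, norm_smul, Real.norm_of_nonneg (Real.exp_nonneg _),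
          ← dist_eq_norm (b₁ s)] at e2
        have e4 := BoundedContinuousFunction.dist_coe_le_dist (f := b₁) (g := b₂) s
        have e5 : K * (Real.exp (2 * K * |s|) * dist (b₁ s) (b₂ s))
            ≤ K * (Real.exp (2 * K * |s|) * dist b₁ b₂) := by gcongr
        linarith) t
    rw [intervalIntegral.integral_sub ((hcont _ b₁.continuous).intervalIntegrable _ _)
      ((hcont _ b₂.continuous).intervalIntegrable _ _)] at h1
    simp only [T, BoundedContinuousFunction.coe_ofNormedAddCommGroup]
    rw [dist_eq_norm, ← smul_sub, add_sub_add_left_eq_sub, norm_smul,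
      Real.norm_of_nonneg (Real.exp_nonneg _), Real.exp_neg, inv_mul_le_iff₀ (by positivity)]
    refine h1.trans (le_of_eq ?_)
    push_cast
    field_simp
  obtain ⟨b, hb⟩ : ∃ b, T b = b := ⟨_, hT.fixedPoint_isFixedPt⟩
  have hx : ∀ t, Real.exp (2 * K * |t|) • b t
      = x₀ + ∫ s in (0 : ℝ)..t, g s (Real.exp (2 * K * |s|) • b s) := by
    intro t
    conv_lhs => rw [← hb]
    simp only [T, BoundedContinuousFunction.coe_ofNormedAddCommGroup]
    rw [smul_smul, ← Real.exp_add, add_neg_cancel, Real.exp_zero, one_smul]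
  refine ⟨fun t => Real.exp (2 * K * |t|) • b t, by simpa using hx 0, fun t => ?_⟩
  have h1 := ((hcont b b.continuous).integral_hasStrictDerivAt 0 t).hasDerivAt.const_add x₀
  exact h1.congr_of_eventuallyEq (Filter.Eventually.of_forall hx)

/-! ### Initial value problems of second order -/

/-- The bound 1 ≤ K accounts for the component x' = v of the phase-space field, whose Lipschitz
constant is 1. -/
theorem lipschitzWith_phase {g : ℝ → ℝ → ℝ} {K : ℝ} (hK : 1 ≤ K)
    (hL : ∀ t x y, |g x t - g y t| ≤ K * |x - y|) (t : ℝ) :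
    LipschitzWith K.toNNReal fun z : ℝ × ℝ => (z.2, -g z.1 t) := by
  refine LipschitzWith.of_dist_le_mul fun z z' => ?_
  rw [Real.coe_toNNReal _ (by linarith), Prod.dist_eq, Prod.dist_eq]
  have h1 := hL t z.1 z'.1
  simp only [Real.dist_eq]
  have h2 : |z.1 - z'.1| ≤ max |z.1 - z'.1| |z.2 - z'.2| := le_max_left _ _
  have h3 : |z.2 - z'.2| ≤ max |z.1 - z'.1| |z.2 - z'.2| := le_max_right _ _
  have h4 : |-g z.1 t - -g z'.1 t| = |g z.1 t - g z'.1 t| := by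
    rw [← abs_neg]; congr 1; ring
  refine max_le ?_ ?_
  · nlinarith [abs_nonneg (z.2 - z'.2)]
  · rw [h4]
    refine h1.trans ?_
    gcongr

theorem IsSolutionIVP.hasDerivAt {g : ℝ → ℝ → ℝ} {a v : ℝ} {x : ℝ → ℝ}
    (h : IsSolutionIVP g a v x) (t : ℝ) : HasDerivAt x (deriv x t) t :=
  (h.differentiable t).hasDerivAt

theorem IsSolutionIVP.continuous {g : ℝ → ℝ → ℝ} {a v : ℝ} {x : ℝ → ℝ}
    (h : IsSolutionIVP g a v x) : Continuous x := h.differentiable.continuous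

theorem IsSolutionIVP.continuous_deriv {g : ℝ → ℝ → ℝ} {a v : ℝ} {x : ℝ → ℝ}
    (h : IsSolutionIVP g a v x) : Continuous (deriv x) :=
  continuous_iff_continuousAt.2 fun t => (h.equation t).continuousAt

theorem IsSolutionIVP.hasDerivAt_phase {g : ℝ → ℝ → ℝ} {a v : ℝ} {x : ℝ → ℝ}
    (h : IsSolutionIVP g a v x) (t : ℝ) :
    HasDerivAt (fun t => (x t, deriv x t)) (deriv x t, -g (x t) t) t :=
  (h.hasDerivAt t).prodMk (h.equation t)

/-- A solution is determined by its value and its velocity at any time. -/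
theorem IsSolutionIVP.ext_of_eq_at {g : ℝ → ℝ → ℝ} {K a v a' v' : ℝ} {x y : ℝ → ℝ}
    (hL : ∀ t x y, |g x t - g y t| ≤ K * |x - y|)
    (hx : IsSolutionIVP g a v x) (hy : IsSolutionIVP g a' v' y) {t₀ : ℝ}
    (h₀ : x t₀ = y t₀) (h₁ : deriv x t₀ = deriv y t₀) : x = y := by
  have hL' : ∀ t x y, |g x t - g y t| ≤ max 1 K * |x - y| := fun t x y =>
    (hL t x y).trans (by gcongr; exact le_max_right _ _)
  have := ODE_solution_unique_univ (s := fun _ => univ) (t₀ := t₀)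
    (v := fun t (z : ℝ × ℝ) => (z.2, -g z.1 t))
    (fun t => (lipschitzWith_phase (le_max_left 1 K) hL' t).lipschitzOnWith)
    (fun t => ⟨hx.hasDerivAt_phase t, mem_univ _⟩) (fun t => ⟨hy.hasDerivAt_phase t, mem_univ _⟩)
    (by simp [h₀, h₁])
  funext t
  exact congrArg Prod.fst (congrFun this t)

theorem IsSolutionIVP.of_hasDerivAt {g : ℝ → ℝ → ℝ} {x y : ℝ → ℝ}
    (hx : ∀ t, HasDerivAt x (y t) t) (hy : ∀ t, HasDerivAt y (-g (x t) t) t) :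
    IsSolutionIVP g (x 0) (y 0) x := by
  have h : deriv x = y := funext fun t => (hx t).deriv
  exact ⟨fun t => (hx t).differentiableAt, by rwa [h], rfl, by rw [h]⟩

theorem exists_isSolutionIVP {g : ℝ → ℝ → ℝ} {K C : ℝ} (hc : Continuous (Function.uncurry g))
    (hL : ∀ t x y, |g x t - g y t| ≤ K * |x - y|) (hC : ∀ t, |g 0 t| ≤ C) (a v : ℝ) :
    ∃ x, IsSolutionIVP g a v x := by
  have hL' : ∀ t x y, |g x t - g y t| ≤ max 1 K * |x - y| := fun t x y =>
    (hL t x y).trans (by gcongr; exact le_max_right _ _)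
  obtain ⟨z, hz0, hz⟩ := exists_global_solution (g := fun t (z : ℝ × ℝ) => (z.2, -g z.1 t))
    (K := max 1 K) (C := C) (by positivity)
    (by
      have : Continuous fun q : ℝ × ℝ × ℝ => g q.2.1 q.1 :=
        hc.comp (by fun_prop : Continuous fun q : ℝ × ℝ × ℝ => (q.2.1, q.1))
      exact (by fun_prop : Continuous fun q : ℝ × ℝ × ℝ => (q.2.2, -g q.2.1 q.1)))
    (fun t x y => by
      have := (lipschitzWith_phase (le_max_left 1 K) hL' t).dist_le_mul x y
      rwa [Real.coe_toNNReal _ (by positivity), dist_eq_norm, dist_eq_norm] at this)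
    (fun t => by simpa [Prod.norm_def] using hC t) (a, v)
  have h1 := IsSolutionIVP.of_hasDerivAt (g := g) (x := fun t => (z t).1) (y := fun t => (z t).2)
    (fun t => (hasFDerivAt_fst (𝕜 := ℝ) (p := z t)).comp_hasDerivAt t (hz t))
    (fun t => (hasFDerivAt_snd (𝕜 := ℝ) (p := z t)).comp_hasDerivAt t (hz t))
  rw [hz0] at h1
  exact ⟨_, h1⟩

theorem gronwallBound_le_mul {δ K ε t : ℝ} (hK : 1 ≤ K) (hε : 0 ≤ ε) :
    gronwallBound δ K ε t ≤ (δ + ε) * Real.exp (K * t) := by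
  rw [gronwallBound_of_K_ne_0 (by linarith)]
  have h1 : ε / K ≤ ε := div_le_self hε hK
  have h2 : 0 ≤ ε / K := by positivity
  have h3 := Real.exp_pos (K * t)
  simp only
  nlinarith

/-- Continuous dependence of solutions on the initial data and on the equation. -/
theorem IsSolutionIVP.abs_sub_le {g h : ℝ → ℝ → ℝ} {K T ε δ a v a' v' : ℝ} {x y : ℝ → ℝ}
    (hK : 1 ≤ K) (hL : ∀ t x y, |g x t - g y t| ≤ K * |x - y|)
    (hx : IsSolutionIVP g a v x) (hy : IsSolutionIVP h a' v' y) (hε : 0 ≤ ε)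
    (hgh : ∀ t ∈ Icc 0 T, |g (y t) t - h (y t) t| ≤ ε) (ha : |a - a'| ≤ δ) (hv : |v - v'| ≤ δ) :
    ∀ t ∈ Icc 0 T, |x t - y t| ≤ (δ + ε) * Real.exp (K * T) ∧
      |deriv x t - deriv y t| ≤ (δ + ε) * Real.exp (K * T) := by
  intro t ht
  have hδ : 0 ≤ δ := (abs_nonneg _).trans ha
  have := dist_le_of_approx_trajectories_ODE (K := K.toNNReal) (a := 0) (b := T)
    (v := fun t (z : ℝ × ℝ) => (z.2, -g z.1 t)) (εf := 0) (εg := ε) (δ := δ)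
    (lipschitzWith_phase hK hL)
    (fun t _ => (hx.hasDerivAt_phase t).continuousAt.continuousWithinAt)
    (fun t _ => (hx.hasDerivAt_phase t).hasDerivWithinAt) (fun t _ => by simp)
    (fun t _ => (hy.hasDerivAt_phase t).continuousAt.continuousWithinAt)
    (fun t _ => (hy.hasDerivAt_phase t).hasDerivWithinAt)
    (fun t ht => by
      have := hgh t ⟨ht.1, ht.2.le⟩
      simp only [Prod.dist_eq, dist_self, Real.dist_eq]
      refine max_le hε ?_
      rw [neg_sub_neg]
      exact this)
    (by simp only [Prod.dist_eq, Real.dist_eq, hx.init_pos, hx.init_vel, hy.init_pos, hy.init_vel]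
        exact max_le ha hv) t ht
  rw [zero_add, sub_zero, Real.coe_toNNReal _ (by linarith)] at this
  have h2 := this.trans (gronwallBound_le_mul hK hε)
  have h3 : (δ + ε) * Real.exp (K * t) ≤ (δ + ε) * Real.exp (K * T) := by
    have := ht.2
    gcongr
  rw [Prod.dist_eq, Real.dist_eq, Real.dist_eq] at h2
  exact ⟨(le_max_left _ _).trans (h2.trans h3), (le_max_right _ _).trans (h2.trans h3)⟩

/-- Lagrange's identity for two, possibly inhomogeneous, linear equations of second order. -/
theorem integral_wronskian {q₀ q₁ y y' z z' f : ℝ → ℝ} (hy : ∀ t, HasDerivAt y (y' t) t)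
    (hy' : ∀ t, HasDerivAt y' (-(q₀ t * y t)) t) (hz : ∀ t, HasDerivAt z (z' t) t)
    (hz' : ∀ t, HasDerivAt z' (-(q₁ t * z t + f t)) t) (hq₀ : Continuous q₀) (hq₁ : Continuous q₁)
    (hf : Continuous f) (T : ℝ) :
    ∫ t in (0 : ℝ)..T, ((q₀ t - q₁ t) * y t * z t - f t * y t)
      = (y T * z' T - y' T * z T) - (y 0 * z' 0 - y' 0 * z 0) := by
  have cy : Continuous y := continuous_iff_continuousAt.2 fun t => (hy t).continuousAt
  have cz : Continuous z := continuous_iff_continuousAt.2 fun t => (hz t).continuousAt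
  refine intervalIntegral.integral_eq_sub_of_hasDerivAt (f := fun t => y t * z' t - y' t * z t)
    (fun t _ => ?_) (Continuous.intervalIntegrable (by fun_prop) _ _)
  convert! ((hy t).mul (hz' t)).sub ((hy' t).mul (hz t)) using 1
  ring

/-! ### The Kepler function -/

theorem kepler_unique {e u t : ℝ} (h0 : 0 ≤ e) (h1 : e < 1) (h : u - e * Real.sin u = t) :
    kepler t e = u :=
  (kepler_strictMono h0 h1).injective ((kepler_spec h0 h1 t).trans h.symm)

theorem kepler_zero_right (t : ℝ) : kepler t 0 = t :=
  kepler_unique le_rfl one_pos (by simp)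

theorem abs_kepler_sub_le {e : ℝ} (h0 : 0 ≤ e) (h1 : e < 1) (t : ℝ) : |kepler t e - t| ≤ e := by
  have h := kepler_spec h0 h1 t
  have : kepler t e - t = e * Real.sin (kepler t e) := by linarith
  rw [this, abs_mul, abs_of_nonneg h0]
  nlinarith [Real.abs_sin_le_one (kepler t e)]

theorem kepler_neg {e : ℝ} (h0 : 0 ≤ e) (h1 : e < 1) (t : ℝ) : kepler (-t) e = -kepler t e := by
  refine kepler_unique h0 h1 ?_
  have h := kepler_spec h0 h1 t
  rw [Real.sin_neg]
  linarith

theorem kepler_two_mul_pi_sub {e : ℝ} (h0 : 0 ≤ e) (h1 : e < 1) (m : ℕ) (t : ℝ) :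
    kepler (2 * m * Real.pi - t) e = 2 * m * Real.pi - kepler t e := by
  refine kepler_unique h0 h1 ?_
  have h := kepler_spec h0 h1 t
  have h2 : Real.sin (2 * m * Real.pi - kepler t e) = -Real.sin (kepler t e) := by
    rw [← Real.sin_nat_mul_two_pi_sub (kepler t e) m]
    congr 1
    ring
  rw [h2]
  linarith

theorem one_sub_mul_cos_pos {e : ℝ} (h0 : 0 ≤ e) (h1 : e < 1) (u : ℝ) :
    0 < 1 - e * Real.cos u := by
  nlinarith [Real.cos_le_one u]

/-- The Kepler function is the inverse of an increasing bijection of the line, hence an order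
isomorphism. -/
theorem continuous_kepler {e : ℝ} (h0 : 0 ≤ e) (h1 : e < 1) :
    Continuous fun t => kepler t e := by
  have h : (fun t => kepler t e)
      = ((kepler_strictMono h0 h1).orderIsoOfSurjective _
          fun t => ⟨kepler t e, kepler_spec h0 h1 t⟩).symm := by
    funext t
    refine kepler_unique h0 h1 ?_
    exact ((kepler_strictMono h0 h1).orderIsoOfSurjective _
          fun t => ⟨kepler t e, kepler_spec h0 h1 t⟩).apply_symm_apply t
  rw [h]
  exact OrderIso.continuous _

theorem hasDerivAt_kepler {e : ℝ} (h0 : 0 ≤ e) (h1 : e < 1) (t : ℝ) :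
    HasDerivAt (fun t => kepler t e) (1 - e * Real.cos (kepler t e))⁻¹ t := by
  have h : HasDerivAt (fun u : ℝ => u - e * Real.sin u) (1 - e * Real.cos (kepler t e))
      (kepler t e) :=
    (hasDerivAt_id _).sub ((Real.hasDerivAt_sin _).const_mul e)
  exact h.of_local_left_inverse (continuous_kepler h0 h1).continuousAt
    (one_sub_mul_cos_pos h0 h1 _).ne' (Filter.Eventually.of_forall fun s => kepler_spec h0 h1 s)

theorem r_zero_right (t : ℝ) : r t 0 = 1 / 2 := by simp [r]

theorem r_neg {e : ℝ} (h0 : 0 ≤ e) (h1 : e < 1) (t : ℝ) : r (-t) e = r t e := by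
  rw [r, r, kepler_neg h0 h1, Real.cos_neg]

theorem r_two_mul_pi_sub {e : ℝ} (h0 : 0 ≤ e) (h1 : e < 1) (m : ℕ) (t : ℝ) :
    r (2 * m * Real.pi - t) e = r t e := by
  rw [r, r, kepler_two_mul_pi_sub h0 h1, ← Real.cos_nat_mul_two_pi_sub (kepler t e) m]
  congr 5
  ring

/-- Source of the numerical constants for e ≤ 1/2: it makes the inverse distance at most 4 and
|∂F/∂x| at most 256. -/
theorem one_fourth_le_r {e : ℝ} (h0 : 0 ≤ e) (h1 : e ≤ 1 / 2) (t : ℝ) : 1 / 4 ≤ r t e := by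
  rw [r]
  nlinarith [Real.cos_le_one (kepler t e)]

theorem continuous_r {e : ℝ} (h0 : 0 ≤ e) (h1 : e < 1) : Continuous fun t => r t e := by
  have := continuous_kepler h0 h1
  unfold r
  fun_prop

theorem hasDerivAt_r {e : ℝ} (h0 : 0 ≤ e) (h1 : e < 1) (t : ℝ) :
    HasDerivAt (fun t => r t e)
      (1 / 4 * e * Real.sin (kepler t e) / r t e) t := by
  have h := (((hasDerivAt_kepler h0 h1 t).cos.const_mul e).const_sub 1).const_mul (1 / 2)
  have h2 := one_sub_mul_cos_pos h0 h1 (kepler t e)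
  convert! h using 1
  rw [r]
  field_simp
  ring

/-! ### The force -/

/-- The inverse `(x² + ρ²)^{-1/2}` of the distance. -/
def invDist (x ρ : ℝ) : ℝ := (√(x ^ 2 + ρ ^ 2))⁻¹

/-- The derivative `∂/∂x` of the force `x (x² + ρ²)^{-3/2}`. -/
def stiffness (x ρ : ℝ) : ℝ := invDist x ρ ^ 3 - 3 * x ^ 2 * invDist x ρ ^ 5

theorem invDist_pos {x ρ : ℝ} (h : 0 < ρ) : 0 < invDist x ρ := by
  unfold invDist
  positivity

theorem invDist_sq_mul {x ρ : ℝ} (h : 0 < ρ) : invDist x ρ ^ 2 * (x ^ 2 + ρ ^ 2) = 1 := by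
  rw [invDist, inv_pow, Real.sq_sqrt (by positivity)]
  exact inv_mul_cancel₀ (by positivity)

/-- Positivity selects the root of the polynomial relation. This turns the second equation of `bvp`
back into the inverse distance. -/
theorem invDist_eq_of_sq_mul {x ρ w : ℝ} (hw : 0 < w) (h : w ^ 2 * (x ^ 2 + ρ ^ 2) = 1) :
    invDist x ρ = w := by
  have h1 : x ^ 2 + ρ ^ 2 = (w⁻¹) ^ 2 := by
    field_simp
    linarith
  rw [invDist, h1, Real.sqrt_sq (by positivity), inv_inv]

theorem F_eq (x t e : ℝ) : F x t e = x * invDist x (r t e) ^ 3 := by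
  have h : 0 ≤ x ^ 2 + r t e ^ 2 := by positivity
  have h2 : (x ^ 2 + r t e ^ 2) ^ (3 / 2 : ℝ) = √(x ^ 2 + r t e ^ 2) ^ 3 := by
    rw [Real.sqrt_eq_rpow, ← Real.rpow_mul_natCast h]
    norm_num
  rw [F, invDist, inv_pow, h2, div_eq_mul_inv]

theorem F_zero_left (t e : ℝ) : F 0 t e = 0 := by simp [F]

theorem F_neg (x t e : ℝ) : F (-x) t e = -F x t e := by
  simp [F, neg_div]

theorem F_zero_right (x t : ℝ) : F x t 0 = x * invDist x (1 / 2) ^ 3 := by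
  rw [F_eq, r_zero_right]

theorem F_zero_right_pos {x : ℝ} (hx : 0 < x) (t : ℝ) : 0 < F x t 0 := by
  rw [F_zero_right]
  exact mul_pos hx (pow_pos (invDist_pos (by norm_num)) 3)

theorem hasDerivAt_invDist {x ρ : ℝ → ℝ} {x' ρ' t : ℝ} (hx : HasDerivAt x x' t)
    (hρ : HasDerivAt ρ ρ' t) (h : 0 < ρ t) :
    HasDerivAt (fun t => invDist (x t) (ρ t))
      (-(x t * x' + ρ t * ρ') * invDist (x t) (ρ t) ^ 3) t := by
  have h0 : 0 < x t ^ 2 + ρ t ^ 2 := by positivity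
  have h1 := (((hx.pow 2).add (hρ.pow 2)).sqrt h0.ne').inv (by positivity)
  convert! h1 using 1
  have h2 : 0 < √(x t ^ 2 + ρ t ^ 2) := by positivity
  simp only [invDist, Pi.add_apply, Pi.pow_apply]
  field_simp
  ring

theorem hasDerivAt_force {x ρ : ℝ → ℝ} {x' ρ' t : ℝ} (hx : HasDerivAt x x' t)
    (hρ : HasDerivAt ρ ρ' t) (h : 0 < ρ t) :
    HasDerivAt (fun t => x t * invDist (x t) (ρ t) ^ 3)
      (stiffness (x t) (ρ t) * x' - 3 * x t * ρ t * ρ' * invDist (x t) (ρ t) ^ 5) t := by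
  convert! hx.mul ((hasDerivAt_invDist hx hρ h).pow 3) using 1
  simp only [stiffness, Pi.pow_apply]
  push_cast
  ring

theorem hasDerivAt_F_left {e t : ℝ} (h : 0 < r t e) (x : ℝ) :
    HasDerivAt (fun x => F x t e) (stiffness x (r t e)) x := by
  simp only [F_eq]
  have := hasDerivAt_force (hasDerivAt_id x) (hasDerivAt_const x (r t e)) h
  simpa using this

/-- The partial derivative `∂F/∂t`. -/
def forceDot (x t e : ℝ) : ℝ :=
  -(3 / 4) * e * (x * Real.sin (kepler t e) * invDist x (r t e) ^ 5)

theorem hasDerivAt_F_comp {e : ℝ} (h0 : 0 ≤ e) (h1 : e ≤ 1 / 2) {x : ℝ → ℝ} {x' t : ℝ}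
    (hx : HasDerivAt x x' t) :
    HasDerivAt (fun t => F (x t) t e) (stiffness (x t) (r t e) * x' + forceDot (x t) t e) t := by
  simp only [F_eq]
  have hr := one_fourth_le_r h0 h1 t
  have hr' : 0 < r t e := by linarith
  convert! hasDerivAt_force hx (hasDerivAt_r h0 (by linarith) t) hr' using 1
  rw [forceDot]
  field_simp
  ring

theorem potential_eq {φ : ℝ → ℝ → ℝ} {e : ℝ} (h0 : 0 ≤ e) (h1 : e ≤ 1 / 2) (t : ℝ) :
    potential φ e t = stiffness (φ t e) (r t e) :=
  (hasDerivAt_F_left (by linarith [one_fourth_le_r h0 h1 t]) _).deriv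

theorem invDist_le_four {x ρ : ℝ} (h : 1 / 4 ≤ ρ) : invDist x ρ ≤ 4 := by
  have h1 := invDist_pos (x := x) (by linarith : 0 < ρ)
  have h2 := invDist_sq_mul (x := x) (by linarith : 0 < ρ)
  by_contra! h3
  have h4 : 16 < invDist x ρ ^ 2 := by nlinarith
  have h5 : 1 / 16 ≤ x ^ 2 + ρ ^ 2 := by nlinarith [sq_nonneg x]
  nlinarith

theorem abs_stiffness_le {x ρ : ℝ} (h : 1 / 4 ≤ ρ) : |stiffness x ρ| ≤ 256 := by
  have h1 := invDist_pos (x := x) (by linarith : 0 < ρ)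
  have h2 := invDist_sq_mul (x := x) (by linarith : 0 < ρ)
  have h3 := invDist_le_four (x := x) h
  have h4 : x ^ 2 * invDist x ρ ^ 2 ≤ 1 := by nlinarith [sq_nonneg (invDist x ρ * ρ)]
  have h5 : invDist x ρ ^ 3 ≤ 4 ^ 3 := by gcongr
  have h6 : 0 < invDist x ρ ^ 3 := by positivity
  have h7 : stiffness x ρ = invDist x ρ ^ 3 * (1 - 3 * (x ^ 2 * invDist x ρ ^ 2)) := by
    rw [stiffness]; ring
  have h8 : 0 ≤ x ^ 2 * invDist x ρ ^ 2 := by positivity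
  rw [h7, abs_mul, abs_of_pos h6]
  -- Since 0 ≤ x²w² ≤ 1, the factor lies in [-2, 1]; the generous 4 gives 256 = 4³ · 4.
  have h9 : |1 - 3 * (x ^ 2 * invDist x ρ ^ 2)| ≤ 4 := by
    rw [abs_le]; constructor <;> linarith
  nlinarith [abs_nonneg (1 - 3 * (x ^ 2 * invDist x ρ ^ 2))]

theorem abs_force_sub_le {ρ : ℝ} (h : 1 / 4 ≤ ρ) (x y : ℝ) :
    |x * invDist x ρ ^ 3 - y * invDist y ρ ^ 3| ≤ 256 * |x - y| := by
  have hd : ∀ x : ℝ, HasDerivAt (fun x => x * invDist x ρ ^ 3) (stiffness x ρ) x := fun x => by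
    simpa using hasDerivAt_force (hasDerivAt_id x) (hasDerivAt_const x ρ) (by linarith)
  have := Convex.norm_image_sub_le_of_norm_hasDerivWithin_le (𝕜 := ℝ) (s := univ) (C := 256)
    (fun x _ => (hd x).hasDerivWithinAt)
    (fun x _ => abs_stiffness_le h) convex_univ (mem_univ y) (mem_univ x)
  simpa using this

theorem abs_F_sub_le {e : ℝ} (h0 : 0 ≤ e) (h1 : e ≤ 1 / 2) (t x y : ℝ) :
    |F x t e - F y t e| ≤ 256 * |x - y| := by
  rw [F_eq, F_eq]
  exact abs_force_sub_le (one_fourth_le_r h0 h1 t) x y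

theorem continuous_invDist_comp {X : Type*} [TopologicalSpace X] {x ρ : X → ℝ} (hx : Continuous x)
    (hρ : Continuous ρ) (h : ∀ t, 0 < ρ t) : Continuous fun t => invDist (x t) (ρ t) := by
  unfold invDist
  exact Continuous.inv₀ (by fun_prop) fun t => by
    have := h t
    positivity

theorem continuous_stiffness_comp {x ρ : ℝ → ℝ} (hx : Continuous x) (hρ : Continuous ρ)
    (h : ∀ t, 0 < ρ t) : Continuous fun t => stiffness (x t) (ρ t) := by
  have := continuous_invDist_comp hx hρ h
  unfold stiffness
  fun_prop

theorem exists_solution_F {e : ℝ} (h0 : 0 ≤ e) (h1 : e ≤ 1 / 2) (v : ℝ) :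
    ∃ x, IsSolutionIVP (fun x t => F x t e) 0 v x := by
  refine exists_isSolutionIVP (K := 256) (C := 0) ?_ (abs_F_sub_le h0 h1)
    (by simp [F_zero_left]) 0 v
  have hr : Continuous fun q : ℝ × ℝ => r q.2 e :=
    (continuous_r h0 (by linarith)).comp continuous_snd
  have := continuous_invDist_comp continuous_fst hr
    fun q => by linarith [one_fourth_le_r h0 h1 q.2]
  have h : (Function.uncurry fun x t => F x t e)
      = fun q : ℝ × ℝ => q.1 * invDist q.1 (r q.2 e) ^ 3 := by
    funext q
    exact F_eq _ _ _
  rw [h]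
  fun_prop

theorem exists_solution_linear {q f : ℝ → ℝ} {C D : ℝ} (hq : Continuous q) (hC : ∀ t, |q t| ≤ C)
    (hf : Continuous f) (hD : ∀ t, |f t| ≤ D) (a v : ℝ) :
    ∃ x, IsSolutionIVP (fun x t => q t * x + f t) a v x := by
  refine exists_isSolutionIVP (K := C) (C := D) ?_ (fun t x y => ?_) (by simpa using hD) a v
  · have h1 : Continuous fun p : ℝ × ℝ => q p.2 * p.1 + f p.2 := by fun_prop
    exact h1
  · rw [show q t * x + f t - (q t * y + f t) = q t * (x - y) by ring, abs_mul]
    have := hC t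
    gcongr

theorem abs_mul_sub_mul_le {q : ℝ → ℝ} {C : ℝ} (hC : ∀ t, |q t| ≤ C) (t x y : ℝ) :
    |q t * x - q t * y| ≤ C * |x - y| := by
  rw [← mul_sub, abs_mul]
  have := hC t
  gcongr

/-! ### Symmetries of the solutions -/

/-- F is odd in x and r is even in t, so -x(-t) solves the same initial value problem. -/
theorem IsSolutionIVP.odd {e v : ℝ} (h0 : 0 ≤ e) (h1 : e ≤ 1 / 2) {x : ℝ → ℝ}
    (hx : IsSolutionIVP (fun x t => F x t e) 0 v x) (t : ℝ) : x (-t) = -x t := by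
  have hneg : ∀ t : ℝ, HasDerivAt (fun t : ℝ => -t) (-1) t := fun t => hasDerivAt_neg t
  have h := IsSolutionIVP.of_hasDerivAt (g := fun x t => F x t e) (x := fun t => -x (-t))
    (y := fun t => deriv x (-t))
    (fun t => by
      convert! ((hx.hasDerivAt (-t)).comp t (hneg t)).neg using 1
      ring)
    (fun t => by
      convert! (hx.equation (-t)).comp t (hneg t) using 1
      simp only [F_neg]
      rw [F_eq, F_eq, r_neg h0 (by linarith)]
      ring)
  have h2 := hx.ext_of_eq_at (abs_F_sub_le h0 h1) h (t₀ := 0) (by simp [hx.init_pos])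
    (by rw [h.init_vel, neg_zero])
  have := congrFun h2 t
  linarith

/-- The solution is antisymmetric with respect to each of its zeros at the apsides. -/
theorem IsSolutionIVP.antisymm {e v : ℝ} (h0 : 0 ≤ e) (h1 : e ≤ 1 / 2) {x : ℝ → ℝ}
    (hx : IsSolutionIVP (fun x t => F x t e) 0 v x) {m : ℕ} (hm : x (m * Real.pi) = 0) (t : ℝ) :
    x (2 * m * Real.pi - t) = -x t := by
  have hneg : ∀ t : ℝ, HasDerivAt (fun t : ℝ => 2 * m * Real.pi - t) (-1) t := fun t => by
    simpa using (hasDerivAt_id t).const_sub (2 * m * Real.pi)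
  have hd : ∀ t, HasDerivAt (fun t => -x (2 * m * Real.pi - t)) (deriv x (2 * m * Real.pi - t)) t :=
    fun t => by
      convert! ((hx.hasDerivAt (2 * m * Real.pi - t)).comp t (hneg t)).neg using 1
      ring
  have h := IsSolutionIVP.of_hasDerivAt (g := fun x t => F x t e) hd
    (fun t => by
      convert! (hx.equation (2 * m * Real.pi - t)).comp t (hneg t) using 1
      simp only [F_neg]
      rw [F_eq, F_eq, r_two_mul_pi_sub h0 (by linarith)]
      ring)
  have e1 : 2 * m * Real.pi - m * Real.pi = m * Real.pi := by ring
  -- The reflection fixes mπ, where both solutions vanish and have equal velocities.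
  have h2 := hx.ext_of_eq_at (abs_F_sub_le h0 h1) h (t₀ := m * Real.pi) (by simp only [e1]; simp [hm])
    (by rw [(hd _).deriv, e1])
  have := congrFun h2 t
  linarith

/-- Conservation of energy in the circular problem. -/
theorem IsSolutionIVP.energy {v : ℝ} {x : ℝ → ℝ}
    (hx : IsSolutionIVP (fun x t => F x t 0) 0 v x) (t : ℝ) :
    deriv x t ^ 2 / 2 - invDist (x t) (1 / 2) = v ^ 2 / 2 - 2 := by
  have hd : ∀ t, HasDerivAt (fun t => deriv x t ^ 2 / 2 - invDist (x t) (1 / 2)) 0 t := fun t => by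
    convert! (((hx.equation t).pow 2).div_const 2).sub
      (hasDerivAt_invDist (hx.hasDerivAt t) (hasDerivAt_const t (1 / 2)) (by norm_num)) using 1
    rw [F_zero_right]
    push_cast
    ring
  have h := is_const_of_deriv_eq_zero (fun t => (hd t).differentiableAt) (fun t => (hd t).deriv) t 0
  -- The inverse distance at the origin is (1/4)^{-1/2} = 2, so the escape velocity is also 2.
  rw [h, hx.init_pos, hx.init_vel, invDist_eq_of_sq_mul (w := 2) (by norm_num) (by norm_num)]

/-- The velocity solves the linearized circular problem. -/
theorem IsSolutionIVP.deriv_solution {v : ℝ} {x : ℝ → ℝ}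
    (hx : IsSolutionIVP (fun x t => F x t 0) 0 v x) :
    IsSolutionIVP (fun y t => stiffness (x t) (1 / 2) * y) v 0 (deriv x) := by
  have h := IsSolutionIVP.of_hasDerivAt (g := fun y t => stiffness (x t) (1 / 2) * y)
    (x := deriv x) (y := fun t => -F (x t) t 0) hx.equation
    (fun t => by
      convert! (hasDerivAt_F_comp le_rfl (by norm_num) (hx.hasDerivAt t)).neg using 1
      rw [forceDot, r_zero_right]
      ring)
  simp only [hx.init_pos, hx.init_vel, F_zero_left, neg_zero] at h
  exact h

/-! ### Families that are Lipschitz continuous in the parameter at `0` -/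

/-- The family `f e t` is bounded and `f e t - f 0 t = O(e)`, uniformly for `0 ≤ t ≤ T`, as
`e → 0+`. -/
def LipAtZero (T : ℝ) (f : ℝ → ℝ → ℝ) : Prop :=
  ∃ C δ : ℝ, 0 < δ ∧ 0 ≤ C ∧ ∀ e ∈ Ico 0 δ, ∀ t ∈ Icc 0 T, |f e t| ≤ C ∧ |f e t - f 0 t| ≤ C * e

namespace LipAtZero

variable {T : ℝ} {f g : ℝ → ℝ → ℝ}

/-- Boundedness follows from compactness at e = 0 together with the bound on the increments. -/
theorem of_bound {C δ : ℝ} (hδ : 0 < δ) (hf : ContinuousOn (f 0) (Icc 0 T))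
    (h : ∀ e ∈ Ico 0 δ, ∀ t ∈ Icc 0 T, |f e t - f 0 t| ≤ C * e) : LipAtZero T f := by
  obtain ⟨B, hB⟩ := isCompact_Icc.exists_bound_of_continuousOn hf
  refine ⟨max |C| (|C| * δ + |B|), δ, hδ, (abs_nonneg C).trans (le_max_left _ _),
    fun e he t ht => ⟨?_, ?_⟩⟩
  · refine le_trans ?_ (le_max_right _ _)
    have h1 := h e he t ht
    have h2 := hB t ht
    rw [Real.norm_eq_abs] at h2
    have h3 : C * e ≤ |C| * δ := by
      have := le_abs_self C
      have := he.1
      have := he.2.le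
      gcongr
    have h4 := abs_sub_abs_le_abs_sub (f e t) (f 0 t)
    linarith [le_abs_self B]
  · refine (h e he t ht).trans (mul_le_mul_of_nonneg_right ?_ he.1)
    exact (le_abs_self C).trans (le_max_left _ _)

theorem const {f : ℝ → ℝ} (hf : Continuous f) : LipAtZero T fun _ => f :=
  of_bound (C := 0) one_pos hf.continuousOn (by simp)

theorem param : LipAtZero T fun e _ => e :=
  of_bound (C := 1) one_pos continuousOn_const fun e he t _ => by simp [abs_of_nonneg he.1]

theorem add (hf : LipAtZero T f) (hg : LipAtZero T g) :
    LipAtZero T fun e t => f e t + g e t := by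
  obtain ⟨C, δ, hδ, hC, h⟩ := hf
  obtain ⟨C', δ', hδ', hC', h'⟩ := hg
  refine ⟨C + C', min δ δ', by positivity, by positivity, fun e he t ht => ?_⟩
  obtain ⟨h1, h2⟩ := h e ⟨he.1, he.2.trans_le (min_le_left _ _)⟩ t ht
  obtain ⟨h1', h2'⟩ := h' e ⟨he.1, he.2.trans_le (min_le_right _ _)⟩ t ht
  refine ⟨(abs_add_le _ _).trans (by linarith), ?_⟩
  rw [show f e t + g e t - (f 0 t + g 0 t) = (f e t - f 0 t) + (g e t - g 0 t) by ring]
  exact (abs_add_le _ _).trans (by linarith)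

theorem mul (hf : LipAtZero T f) (hg : LipAtZero T g) :
    LipAtZero T fun e t => f e t * g e t := by
  obtain ⟨C, δ, hδ, hC, h⟩ := hf
  obtain ⟨C', δ', hδ', hC', h'⟩ := hg
  refine ⟨2 * (C * C'), min δ δ', by positivity, by positivity, fun e he t ht => ?_⟩
  obtain ⟨h1, h2⟩ := h e ⟨he.1, he.2.trans_le (min_le_left _ _)⟩ t ht
  obtain ⟨h1', h2'⟩ := h' e ⟨he.1, he.2.trans_le (min_le_right _ _)⟩ t ht
  obtain ⟨h1'', -⟩ := h' 0 ⟨le_rfl, hδ'⟩ t ht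
  have hCC : 0 ≤ C * C' := by positivity
  constructor
  · rw [abs_mul]
    have : |f e t| * |g e t| ≤ C * C' := by gcongr
    linarith
  · rw [show f e t * g e t - f 0 t * g 0 t
      = f e t * (g e t - g 0 t) + (f e t - f 0 t) * g 0 t by ring]
    refine (abs_add_le _ _).trans ?_
    rw [abs_mul, abs_mul]
    have e1 : |f e t| * |g e t - g 0 t| ≤ C * (C' * e) := by gcongr
    have e2 : |f e t - f 0 t| * |g 0 t| ≤ (C * e) * C' := by
      have := he.1
      gcongr
    linarith

theorem const_mul (c : ℝ) (hf : LipAtZero T f) : LipAtZero T fun e t => c * f e t :=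
  (const (f := fun _ => c) continuous_const).mul hf

theorem pow (hf : LipAtZero T f) (n : ℕ) : LipAtZero T fun e t => f e t ^ n := by
  induction n with
  | zero => simpa using const (T := T) (f := fun _ => 1) continuous_const
  | succ n ih => simpa only [pow_succ] using ih.mul hf

theorem congr (hf : LipAtZero T f) {ε : ℝ} (hε : 0 < ε)
    (h : ∀ e ∈ Ico 0 ε, ∀ t ∈ Icc 0 T, g e t = f e t) : LipAtZero T g := by
  obtain ⟨C, δ, hδ, hC, hf⟩ := hf
  refine ⟨C, min δ ε, by positivity, hC, fun e he t ht => ?_⟩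
  rw [h e ⟨he.1, he.2.trans_le (min_le_right _ _)⟩ t ht, h 0 ⟨le_rfl, hε⟩ t ht]
  exact hf e ⟨he.1, he.2.trans_le (min_le_left _ _)⟩ t ht

theorem comp_lipschitz (hf : LipAtZero T f) {G : ℝ → ℝ} {B : ℝ} (hB : ∀ x, |G x| ≤ B)
    (hG : ∀ x y, |G x - G y| ≤ |x - y|) : LipAtZero T fun e t => G (f e t) := by
  obtain ⟨C, δ, hδ, hC, h⟩ := hf
  refine ⟨max C B, δ, hδ, hC.trans (le_max_left _ _),
    fun e he t ht => ⟨(hB _).trans (le_max_right _ _), (hG _ _).trans ?_⟩⟩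
  refine (h e he t ht).2.trans ?_
  have := he.1
  gcongr
  exact le_max_left _ _

theorem sin (hf : LipAtZero T f) : LipAtZero T fun e t => Real.sin (f e t) :=
  hf.comp_lipschitz Real.abs_sin_le_one fun x y => by
    simpa [Real.dist_eq] using Real.lipschitzWith_sin.dist_le_mul x y

theorem cos (hf : LipAtZero T f) : LipAtZero T fun e t => Real.cos (f e t) :=
  hf.comp_lipschitz Real.abs_cos_le_one fun x y => by
    simpa [Real.dist_eq] using Real.lipschitzWith_cos.dist_le_mul x y

theorem invDist (hf : LipAtZero T f) (hg : LipAtZero T g) {ε : ℝ} (hε : 0 < ε)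
    (h : ∀ e ∈ Ico 0 ε, ∀ t ∈ Icc 0 T, 1 / 4 ≤ g e t) :
    LipAtZero T fun e t => invDist (f e t) (g e t) := by
  obtain ⟨C, δ, hδ, hC, hs⟩ := (hf.pow 2).add (hg.pow 2)
  refine ⟨max 4 (32 * C), min δ ε, by positivity, by positivity, fun e he t ht => ?_⟩
  have he' : e ∈ Ico 0 ε := ⟨he.1, he.2.trans_le (min_le_right _ _)⟩
  have hge := h e he' t ht
  have hg0 := h 0 ⟨le_rfl, hε⟩ t ht
  obtain ⟨-, h2⟩ := hs e ⟨he.1, he.2.trans_le (min_le_left _ _)⟩ t ht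
  have p1 := invDist_pos (x := f e t) (by linarith : 0 < g e t)
  have p2 := invDist_pos (x := f 0 t) (by linarith : 0 < g 0 t)
  have l1 := invDist_le_four (x := f e t) hge
  have l2 := invDist_le_four (x := f 0 t) hg0
  have q1 := invDist_sq_mul (x := f e t) (by linarith : 0 < g e t)
  have q2 := invDist_sq_mul (x := f 0 t) (by linarith : 0 < g 0 t)
  refine ⟨(abs_of_pos p1).trans_le (l1.trans (le_max_left _ _)), ?_⟩
  set a := Sitnikov.invDist (f e t) (g e t)
  set b := Sitnikov.invDist (f 0 t) (g 0 t)
  set A := f e t ^ 2 + g e t ^ 2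
  set B := f 0 t ^ 2 + g 0 t ^ 2
  -- Here a² = 1/A and b² = 1/B. The constant 32 comes from ab ≤ 2(a + b) and ab ≤ 16.
  have k1 : (a - b) * (a + b) = a ^ 2 * b ^ 2 * (B - A) := by
    linear_combination -a ^ 2 * q2 + b ^ 2 * q1
  have k2 : |a - b| * (a + b) = a ^ 2 * b ^ 2 * |A - B| := by
    rw [abs_sub_comm A B, ← abs_of_pos (by positivity : 0 < a + b), ← abs_mul, k1, abs_mul,
      abs_of_pos (by positivity : 0 < a ^ 2 * b ^ 2)]
  have k3 : a ^ 2 * b ^ 2 ≤ 32 * (a + b) := by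
    have : a * b ≤ 4 * b := by gcongr
    have : a * b ≤ a * 4 := by gcongr
    have : a * b ≤ 4 * 4 := by gcongr
    nlinarith [mul_pos p1 p2]
  have k4 : |a - b| ≤ 32 * |A - B| := by
    by_contra! hlt
    nlinarith [abs_nonneg (A - B)]
  have k5 : 32 * C * e ≤ max 4 (32 * C) * e := by
    have := he.1
    gcongr
    exact le_max_right _ _
  linarith

/-- The second order smallness of a product of two increments. -/
theorem integral_sub_mul_sub_le (hT : 0 ≤ T) (hf : LipAtZero T f) (hg : LipAtZero T g) :
    ∃ C δ : ℝ, 0 < δ ∧ ∀ e ∈ Ico 0 δ,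
      |∫ t in (0 : ℝ)..T, (f e t - f 0 t) * (g e t - g 0 t)| ≤ C * e ^ 2 := by
  obtain ⟨C, δ, hδ, hC, h⟩ := hf
  obtain ⟨C', δ', hδ', hC', h'⟩ := hg
  refine ⟨C * C' * T, min δ δ', by positivity, fun e he => ?_⟩
  have := intervalIntegral.norm_integral_le_of_norm_le_const (a := 0) (b := T)
    (f := fun t => (f e t - f 0 t) * (g e t - g 0 t)) (C := (C * e) * (C' * e)) (fun t ht => by
      rw [uIoc_of_le hT] at ht
      have h1 := (h e ⟨he.1, he.2.trans_le (min_le_left _ _)⟩ t ⟨ht.1.le, ht.2⟩).2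
      have h2 := (h' e ⟨he.1, he.2.trans_le (min_le_right _ _)⟩ t ⟨ht.1.le, ht.2⟩).2
      rw [Real.norm_eq_abs, abs_mul]
      have := he.1
      gcongr)
  rw [sub_zero, abs_of_nonneg hT] at this
  rw [← Real.norm_eq_abs]
  linarith

end LipAtZero

/-! ### Operations on solutions -/

namespace IsSolutionIVP

variable {g : ℝ → ℝ → ℝ} {q x y : ℝ → ℝ} {a v b w : ℝ}

theorem comp_add_const (hx : IsSolutionIVP g a v x) {s : ℝ} (hg : ∀ x t, g x (t + s) = g x t) :
    IsSolutionIVP g (x s) (deriv x s) fun t => x (t + s) := by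
  have h := IsSolutionIVP.of_hasDerivAt (g := g) (x := fun t => x (t + s))
    (y := fun t => deriv x (t + s)) (fun t => (hx.hasDerivAt (t + s)).comp_add_const t s)
    (fun t => by
      convert! (hx.equation (t + s)).comp_add_const t s using 1
      rw [hg])
  simpa only [zero_add] using h

theorem neg (hx : IsSolutionIVP g a v x) (hg : ∀ x t, g (-x) t = -g x t) :
    IsSolutionIVP g (-a) (-v) fun t => -x t := by
  have h := IsSolutionIVP.of_hasDerivAt (g := g) (x := fun t => -x t) (y := fun t => -deriv x t)
    (fun t => (hx.hasDerivAt t).neg)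
    (fun t => by
      convert! (hx.equation t).neg using 1
      rw [hg])
  rwa [hx.init_pos, hx.init_vel] at h

theorem linear_comb (hx : IsSolutionIVP (fun x t => q t * x) a v x)
    (hy : IsSolutionIVP (fun x t => q t * x) b w y) (c d : ℝ) :
    IsSolutionIVP (fun x t => q t * x) (c * a + d * b) (c * v + d * w)
      fun t => c * x t + d * y t := by
  have h := IsSolutionIVP.of_hasDerivAt (g := fun x t => q t * x) (x := fun t => c * x t + d * y t)
    (y := fun t => c * deriv x t + d * deriv y t)
    (fun t => ((hx.hasDerivAt t).const_mul c).add ((hy.hasDerivAt t).const_mul d))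
    (fun t => by
      convert! ((hx.equation t).const_mul c).add ((hy.equation t).const_mul d) using 1
      ring)
  rwa [hx.init_pos, hx.init_vel, hy.init_pos, hy.init_vel] at h

end IsSolutionIVP

theorem F_zero_right_add (s x t : ℝ) : F x (t + s) 0 = F x t 0 := by
  rw [F_zero_right, F_zero_right]

/-- An odd periodic solution of the circular problem is antiperiodic with respect to half of its
minimal period. -/
theorem IsSolutionIVP.antiperiodic {v P : ℝ} {x : ℝ → ℝ}
    (hx : IsSolutionIVP (fun x t => F x t 0) 0 v x) (hP : IsMinimalPeriod x (2 * P)) (t : ℝ) :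
    x (t + P) = -x t := by
  obtain ⟨⟨hpos, hper⟩, hmin⟩ := hP
  -- Oddness gives x(-P) = -x(P), the period 2P gives x(-P) = x(P).
  have h0 : x P = 0 := by
    have h1 := hx.odd le_rfl (by norm_num) P
    have h2 := hper (-P)
    rw [show -P + 2 * P = P by ring] at h2
    linarith
  have h1 : deriv x P ^ 2 = v ^ 2 := by
    have h2 := hx.energy P
    have h3 := hx.energy 0
    rw [hx.init_pos, hx.init_vel] at h3
    rw [h0] at h2
    linarith
  have hs := hx.comp_add_const (F_zero_right_add P)
  -- Equal velocities would make P a period, against minimality; opposite ones give antiperiodicity.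
  rcases sq_eq_sq_iff_eq_or_eq_neg.1 h1 with h | h
  · have h2 := hs.ext_of_eq_at (abs_F_sub_le le_rfl (by norm_num)) hx (t₀ := 0)
      (by rw [hs.init_pos, hx.init_pos, h0]) (by rw [hs.init_vel, hx.init_vel, h])
    have h3 := hmin (a := P) ⟨by linarith, fun t => congrFun h2 t⟩
    linarith
  · have hn := hx.neg (fun x t => F_neg x t 0)
    have h2 := hs.ext_of_eq_at (abs_F_sub_le le_rfl (by norm_num)) hn (t₀ := 0)
      (by rw [hs.init_pos, hn.init_pos, h0, neg_zero]) (by rw [hs.init_vel, hn.init_vel, h])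
    exact congrFun h2 t

/-! ### Averaging -/

/-- A function of period `P` is orthogonal to `cos` unless `2π` divides `P`. -/
theorem integral_cos_mul_eq_zero {G : ℝ → ℝ} (hG : Continuous G) {P T : ℝ}
    (hP : Function.Periodic G P) (hT : Function.Periodic G T) (hcT : Function.Periodic Real.cos T)
    (hsT : Function.Periodic Real.sin T) (hc : Real.cos P ≠ 1) :
    ∫ t in (0 : ℝ)..T, Real.cos t * G t = 0 := by
  have hshift : ∀ f : ℝ → ℝ, Function.Periodic f T →
      ∫ t in (0 : ℝ)..T, f (t + P) = ∫ t in (0 : ℝ)..T, f t := fun f hf => by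
    rw [intervalIntegral.integral_comp_add_right, zero_add, add_comm]
    simpa using hf.intervalIntegral_add_eq P 0
  have e1 := hshift (fun t => Real.cos t * G t) (hcT.mul hT)
  have e2 := hshift (fun t => Real.sin t * G t) (hsT.mul hT)
  have i1 : ∫ t in (0 : ℝ)..T, Real.cos (t + P) * G (t + P)
      = Real.cos P * (∫ t in (0 : ℝ)..T, Real.cos t * G t)
        - Real.sin P * ∫ t in (0 : ℝ)..T, Real.sin t * G t := by
    rw [← intervalIntegral.integral_const_mul, ← intervalIntegral.integral_const_mul,
      ← intervalIntegral.integral_sub (Continuous.intervalIntegrable (by fun_prop) _ _)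
        (Continuous.intervalIntegrable (by fun_prop) _ _)]
    congr 1
    funext t
    rw [hP t, Real.cos_add]
    ring
  have i2 : ∫ t in (0 : ℝ)..T, Real.sin (t + P) * G (t + P)
      = Real.sin P * (∫ t in (0 : ℝ)..T, Real.cos t * G t)
        + Real.cos P * ∫ t in (0 : ℝ)..T, Real.sin t * G t := by
    rw [← intervalIntegral.integral_const_mul, ← intervalIntegral.integral_const_mul,
      ← intervalIntegral.integral_add (Continuous.intervalIntegrable (by fun_prop) _ _)
        (Continuous.intervalIntegrable (by fun_prop) _ _)]
    congr 1
    funext t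
    rw [hP t, Real.sin_add]
    ring
  rw [i1] at e1
  rw [i2] at e2
  set a := ∫ t in (0 : ℝ)..T, Real.cos t * G t
  set b := ∫ t in (0 : ℝ)..T, Real.sin t * G t
  -- The vector (a, b) is fixed by the rotation through P. Eliminating b leaves the factor (1 - cos
  -- P)² + sin² P = 2(1 - cos P).
  have h1 : (1 - Real.cos P) * (2 * a) = 0 := by
    linear_combination -(1 - Real.cos P) * e1 + Real.sin P * e2 - a * Real.sin_sq_add_cos_sq P
  have h2 : 1 - Real.cos P ≠ 0 := fun h => hc (by linarith)
  have := (mul_eq_zero.1 h1).resolve_left h2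
  linarith

/-- As (w³)' = -3 x x' w⁵, integration by parts yields one third of ∫ cos t · w³ dt, and w is
P-periodic because x is P-antiperiodic. -/
theorem integral_forceDot_eq_zero {v P T : ℝ} {x : ℝ → ℝ}
    (hx : IsSolutionIVP (fun x t => F x t 0) 0 v x) (hP : ∀ t, x (t + P) = -x t)
    (hT : Function.Periodic x T) (hcT : Function.Periodic Real.cos T)
    (hsT : Function.Periodic Real.sin T) (hc : Real.cos P ≠ 1) :
    ∫ t in (0 : ℝ)..T, (x t * Real.sin t * invDist (x t) (1 / 2) ^ 5) * deriv x t = 0 := by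
  have cx := hx.continuous
  have cx' := hx.continuous_deriv
  have cw : Continuous fun t => invDist (x t) (1 / 2) :=
    continuous_invDist_comp cx continuous_const fun _ => by norm_num
  have h0 := integral_cos_mul_eq_zero (G := fun t => invDist (x t) (1 / 2) ^ 3) (by fun_prop)
    (P := P) (fun t => by simp only [hP t, invDist, neg_sq]) (fun t => by simp only [hT t])
    hcT hsT hc
  have h1 : ∫ t in (0 : ℝ)..T, (Real.cos t * invDist (x t) (1 / 2) ^ 3
      - 3 * ((x t * Real.sin t * invDist (x t) (1 / 2) ^ 5) * deriv x t))
      = Real.sin T * invDist (x T) (1 / 2) ^ 3 - Real.sin 0 * invDist (x 0) (1 / 2) ^ 3 := by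
    refine intervalIntegral.integral_eq_sub_of_hasDerivAt
      (f := fun t => Real.sin t * invDist (x t) (1 / 2) ^ 3)
      (fun t _ => ?_) (Continuous.intervalIntegrable (by fun_prop) _ _)
    convert! (Real.hasDerivAt_sin t).mul
      ((hasDerivAt_invDist (hx.hasDerivAt t) (hasDerivAt_const t (1 / 2)) (by norm_num)).pow 3)
      using 1
    simp only [Pi.pow_apply]
    push_cast
    ring
  rw [intervalIntegral.integral_sub (Continuous.intervalIntegrable (by fun_prop) _ _)
    (Continuous.intervalIntegrable (by fun_prop) _ _), h0, intervalIntegral.integral_const_mul,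
    show Real.sin T = Real.sin 0 by simpa using hsT 0, Real.sin_zero] at h1
  linarith

/-! ### Lipschitz dependence of the solutions on the eccentricity -/

/-- This is all that the trace estimate uses of the smoothness of E. -/
theorem exists_abs_sub_le_mul {E : ℝ → ℝ} {ε : ℝ} (hε : 0 < ε) (h : ContDiffOn ℝ ∞ E (Ico 0 ε)) :
    ∃ C δ : ℝ, 0 < δ ∧ ∀ e ∈ Ico 0 δ, |E e - E 0| ≤ C * e := by
  have hd : DifferentiableWithinAt ℝ E (Ico 0 ε) 0 :=
    (h.differentiableOn (by simp)) 0 ⟨le_rfl, hε⟩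
  obtain ⟨C, hC⟩ := hd.hasDerivWithinAt.isBigO_sub.bound
  rw [nhdsWithin_Ico_eq_nhdsGE hε, Filter.prod_pure, Filter.eventually_map] at hC
  obtain ⟨δ, hδ, hs⟩ := (mem_nhdsGE_iff_exists_Ico_subset).1 hC
  refine ⟨C, δ, hδ, fun e he => ?_⟩
  have := hs he
  simpa [abs_of_nonneg he.1] using this

/-- Gronwall's inequality compares with the solution for e = 0, so the dependence of the equation on
e matters only along that one solution. -/
theorem LipAtZero.solution {g : ℝ → ℝ → ℝ → ℝ} {K C δ T : ℝ} (hK : 1 ≤ K) (hδ : 0 < δ)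
    (hL : ∀ e ∈ Ico 0 δ, ∀ t x y, |g e x t - g e y t| ≤ K * |x - y|) {a v : ℝ → ℝ}
    {x : ℝ → ℝ → ℝ} (hx : ∀ e ∈ Ico 0 δ, IsSolutionIVP (g e) (a e) (v e) (x e))
    (ha : ∀ e ∈ Ico 0 δ, |a e - a 0| ≤ C * e) (hv : ∀ e ∈ Ico 0 δ, |v e - v 0| ≤ C * e)
    (hg : LipAtZero T fun e t => g e (x 0 t) t) :
    LipAtZero T x ∧ LipAtZero T fun e => deriv (x e) := by
  obtain ⟨D, δ', hδ', hD, h⟩ := hg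
  have hx0 := hx 0 ⟨le_rfl, hδ⟩
  have key : ∀ e ∈ Ico 0 (min δ δ'), ∀ t ∈ Icc 0 T,
      |x e t - x 0 t| ≤ (C + D) * Real.exp (K * T) * e ∧
      |deriv (x e) t - deriv (x 0) t| ≤ (C + D) * Real.exp (K * T) * e := fun e he t ht => by
    have he1 : e ∈ Ico 0 δ := ⟨he.1, he.2.trans_le (min_le_left _ _)⟩
    have he2 : e ∈ Ico 0 δ' := ⟨he.1, he.2.trans_le (min_le_right _ _)⟩
    have := (hx e he1).abs_sub_le hK (hL e he1) hx0 (mul_nonneg hD he.1)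
      (fun t ht => (h e he2 t ht).2) (ha e he1) (hv e he1) t ht
    rwa [show (C * e + D * e) * Real.exp (K * T) = (C + D) * Real.exp (K * T) * e by ring] at this
  exact ⟨.of_bound (lt_min hδ hδ') hx0.continuous.continuousOn fun e he t ht => (key e he t ht).1,
    .of_bound (lt_min hδ hδ') hx0.continuous_deriv.continuousOn
      fun e he t ht => (key e he t ht).2⟩

theorem lipAtZero_kepler (T : ℝ) : LipAtZero T fun e t => kepler t e := by
  refine .of_bound (C := 1) one_pos ?_ fun e he t _ => ?_
  · simp only [kepler_zero_right]
    exact continuousOn_id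
  · rw [kepler_zero_right, one_mul]
    exact abs_kepler_sub_le he.1 he.2 t

theorem lipAtZero_r (T : ℝ) : LipAtZero T fun e t => r t e := by
  have h : LipAtZero T fun e t => 1 / 2 * (1 + -1 * (e * Real.cos (kepler t e))) :=
    .const_mul _ ((LipAtZero.const continuous_const).add
      (.const_mul _ (LipAtZero.param.mul (lipAtZero_kepler T).cos)))
  refine h.congr one_pos fun e _ t _ => ?_
  rw [r]
  ring

theorem LipAtZero.invDist_r {T : ℝ} {x : ℝ → ℝ → ℝ} (hx : LipAtZero T x) :
    LipAtZero T fun e t => Sitnikov.invDist (x e t) (r t e) :=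
  hx.invDist (lipAtZero_r T) (ε := 1 / 2) (by norm_num)
    fun e he t _ => one_fourth_le_r he.1 he.2.le t

theorem LipAtZero.stiffness {T : ℝ} {x : ℝ → ℝ → ℝ} (hx : LipAtZero T x) :
    LipAtZero T fun e t => Sitnikov.stiffness (x e t) (r t e) := by
  have hw := hx.invDist_r
  have h := (hw.pow 3).add (((hx.pow 2).const_mul (-3)).mul (hw.pow 5))
  refine h.congr one_pos fun e _ t _ => ?_
  rw [Sitnikov.stiffness]
  ring

theorem LipAtZero.force {T : ℝ} {x : ℝ → ℝ → ℝ} (hx : LipAtZero T x) :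
    LipAtZero T fun e t => F (x e t) t e :=
  (hx.mul (hx.invDist_r.pow 3)).congr one_pos fun _ _ _ _ => F_eq _ _ _

/-! ### The trace formula -/

/-- The variation of the trace of the Poincaré matrix, when the unperturbed matrix is
unipotent and upper triangular. -/
theorem trace_sub_two {q₀ q₁ y₁ y₂ z₁ z₂ : ℝ → ℝ} {T : ℝ} (hq₀ : Continuous q₀)
    (hq₁ : Continuous q₁)
    (hy₁ : IsSolutionIVP (fun y t => q₀ t * y) 1 0 y₁)
    (hy₂ : IsSolutionIVP (fun y t => q₀ t * y) 0 1 y₂)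
    (hz₁ : IsSolutionIVP (fun y t => q₁ t * y) 1 0 z₁)
    (hz₂ : IsSolutionIVP (fun y t => q₁ t * y) 0 1 z₂)
    (h1 : y₁ T = 1) (h1' : deriv y₁ T = 0) :
    z₁ T + deriv z₂ T - 2
      = y₂ T * (∫ t in (0 : ℝ)..T, (q₀ t - q₁ t) * (y₁ t * z₁ t))
        + ∫ t in (0 : ℝ)..T, (q₀ t - q₁ t) * (y₁ t * z₂ t - y₂ t * z₁ t) := by
  have key : ∀ {q y z : ℝ → ℝ} {a v b w : ℝ}, Continuous q →
      IsSolutionIVP (fun y t => q₀ t * y) a v y → IsSolutionIVP (fun y t => q t * y) b w z →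
      ∫ t in (0 : ℝ)..T, (q₀ t - q t) * (y t * z t)
        = (y T * deriv z T - deriv y T * z T) - (a * w - v * b) := by
    intro q y z a v b w hq hy hz
    have := integral_wronskian (f := fun _ => 0) hy.hasDerivAt hy.equation hz.hasDerivAt
      (fun t => by simpa using hz.equation t) hq₀ hq continuous_const T
    rw [hy.init_pos, hy.init_vel, hz.init_pos, hz.init_vel] at this
    rw [← this]
    congr 1
    funext t
    ring
  -- The Wronskian gives y₂'(T) = 1. Then k1, k2, k3 have the values z₁'(T), z₂'(T) - 1 and y₂(T)
  -- z₁'(T) - z₁(T) + 1, and z₁'(T) cancels in the combination.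
  have k0 := key hq₀ hy₁ hy₂
  have k1 := key hq₁ hy₁ hz₁
  have k2 := key hq₁ hy₁ hz₂
  have k3 := key hq₁ hy₂ hz₁
  have c1 := hy₁.continuous
  have c2 := hy₂.continuous
  have c3 := hz₁.continuous
  have c4 := hz₂.continuous
  have k4 : ∫ t in (0 : ℝ)..T, (q₀ t - q₁ t) * (y₁ t * z₂ t - y₂ t * z₁ t)
      = (∫ t in (0 : ℝ)..T, (q₀ t - q₁ t) * (y₁ t * z₂ t))
        - ∫ t in (0 : ℝ)..T, (q₀ t - q₁ t) * (y₂ t * z₁ t) := by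
    rw [← intervalIntegral.integral_sub (Continuous.intervalIntegrable (by fun_prop) _ _)
      (Continuous.intervalIntegrable (by fun_prop) _ _)]
    congr 1
    funext t
    ring
  simp only [sub_self, zero_mul, intervalIntegral.integral_zero] at k0
  rw [k4, k1, k2, k3, h1, h1']
  rw [h1, h1'] at k0
  have k5 : deriv y₂ T = 1 := by linarith
  rw [k5]
  ring

/-- The main estimate: `∫ (q(t, e) - q(t, 0)) φ'(t, 0)² dt = O(e²)` off the resonances. -/
theorem integral_potential_sub_le {δ P T : ℝ} (hδ : 0 < δ) (hδ' : δ ≤ 1 / 2) (hT : 0 ≤ T)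
    {v : ℝ → ℝ} {x : ℝ → ℝ → ℝ}
    (hx : ∀ e ∈ Ico 0 δ, IsSolutionIVP (fun x t => F x t e) 0 (v e) (x e))
    (hxT : ∀ e ∈ Ico 0 δ, x e T = 0)
    (hl : LipAtZero T x) (hl' : LipAtZero T fun e => deriv (x e))
    (hP : ∀ t, x 0 (t + P) = -x 0 t) (hper : Function.Periodic (x 0) T)
    (hcT : Function.Periodic Real.cos T) (hsT : Function.Periodic Real.sin T)
    (hc : Real.cos P ≠ 1) :
    ∃ C δ' : ℝ, 0 < δ' ∧ ∀ e ∈ Ico 0 δ',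
      |∫ t in (0 : ℝ)..T, (stiffness (x e t) (r t e) - stiffness (x 0 t) (r t 0))
        * (deriv (x 0) t * deriv (x 0) t)| ≤ C * e ^ 2 := by
  have h0 : (0 : ℝ) ∈ Ico 0 δ := ⟨le_rfl, hδ⟩
  have hpos : ∀ e ∈ Ico 0 δ, ∀ t, 0 < r t e := fun e he t => by
    linarith [one_fourth_le_r he.1 (he.2.le.trans hδ') t]
  have cr : ∀ e ∈ Ico 0 δ, Continuous fun t => r t e := fun e he =>
    continuous_r he.1 (by linarith [he.2])
  have cq : ∀ e ∈ Ico 0 δ, Continuous fun t => stiffness (x e t) (r t e) := fun e he =>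
    continuous_stiffness_comp (hx e he).continuous (cr e he) (hpos e he)
  have cw : ∀ e ∈ Ico 0 δ, Continuous fun t => invDist (x e t) (r t e) := fun e he =>
    continuous_invDist_comp (hx e he).continuous (cr e he) (hpos e he)
  have ck : ∀ e ∈ Ico 0 δ, Continuous fun t => kepler t e := fun e he =>
    continuous_kepler he.1 (by linarith [he.2])
  -- Along the solution ∂F/∂t = -(3/4) e S; because of the factor e, only the value of S at e = 0
  -- enters to first order.
  set S : ℝ → ℝ → ℝ := fun e t =>
    x e t * Real.sin (kepler t e) * invDist (x e t) (r t e) ^ 5 with hS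
  have cS : ∀ e ∈ Ico 0 δ, Continuous (S e) := fun e he => by
    have := (hx e he).continuous
    have := cw e he
    have := ck e he
    simp only [hS]
    fun_prop
  have lS : LipAtZero T S := (hl.mul (lipAtZero_kepler T).sin).mul (hl.invDist_r.pow 5)
  obtain ⟨C₁, δ₁, hδ₁, h1⟩ := LipAtZero.integral_sub_mul_sub_le hT hl.stiffness
    ((LipAtZero.const (hx 0 h0).continuous_deriv).mul hl')
  -- The first family is the parameter itself, whose increment e - 0 is the prefactor of the
  -- forcing.
  obtain ⟨C₂, δ₂, hδ₂, h2⟩ := LipAtZero.integral_sub_mul_sub_le hT LipAtZero.param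
    ((LipAtZero.const (hx 0 h0).continuous_deriv).mul lS)
  refine ⟨C₁ + 3 / 4 * C₂, min δ (min δ₁ δ₂), by positivity, fun e he => ?_⟩
  have he0 : e ∈ Ico 0 δ := ⟨he.1, he.2.trans_le (min_le_left _ _)⟩
  have he1 : e ∈ Ico 0 δ₁ := ⟨he.1, he.2.trans_le ((min_le_right _ _).trans (min_le_left _ _))⟩
  have he2 : e ∈ Ico 0 δ₂ := ⟨he.1, he.2.trans_le ((min_le_right _ _).trans (min_le_right _ _))⟩
  have heh : e ≤ 1 / 2 := he0.2.le.trans hδ'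
  have c1 := (hx 0 h0).continuous_deriv
  have c2 := (hx e he0).continuous_deriv
  have c3 := cq e he0
  have c4 := cq 0 h0
  have c5 := cS e he0
  have c6 := cS 0 h0
  -- Lagrange's identity for the two velocities; the accelerations -F vanish at 0 and T, so no
  -- boundary term survives.
  have w0 := integral_wronskian (T := T) (q₀ := fun t => stiffness (x 0 t) (r t 0))
    (q₁ := fun t => stiffness (x e t) (r t e)) (y := deriv (x 0)) (y' := fun t => -F (x 0 t) t 0)
    (z := deriv (x e)) (z' := fun t => -F (x e t) t e) (f := fun t => -(3 / 4) * e * S e t)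
    (hx 0 h0).equation
    (fun t => by
      convert! (hasDerivAt_F_comp le_rfl (by norm_num) ((hx 0 h0).hasDerivAt t)).neg using 1
      rw [forceDot]
      ring)
    (hx e he0).equation
    (fun t => (hasDerivAt_F_comp he.1 heh ((hx e he0).hasDerivAt t)).neg)
    c4 c3 (by fun_prop)
  simp only [hxT e he0, hxT 0 h0, (hx e he0).init_pos, (hx 0 h0).init_pos, F_zero_left] at w0
  have a1 := h1 e he1
  have a2 := h2 e he2
  have z := integral_forceDot_eq_zero (hx 0 h0) hP hper hcT hsT hc
  have s0 : ∀ t, S 0 t = x 0 t * Real.sin t * invDist (x 0 t) (1 / 2) ^ 5 := fun t => by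
    simp only [hS, kepler_zero_right, r_zero_right]
  simp only [← s0] at z
  -- On the right, the first integral is zero by w0 and that of S 0 by averaging. Apart from the
  -- integral to be estimated, only products of two increments remain.
  have b1 : ∫ t in (0 : ℝ)..T, (stiffness (x e t) (r t e) - stiffness (x 0 t) (r t 0)) *
      (deriv (x 0) t * deriv (x e) t - deriv (x 0) t * deriv (x 0) t)
      = (∫ t in (0 : ℝ)..T, -((stiffness (x 0 t) (r t 0) - stiffness (x e t) (r t e))
          * deriv (x 0) t * deriv (x e) t - -(3 / 4) * e * S e t * deriv (x 0) t))
        + ((3 / 4) * (∫ t in (0 : ℝ)..T, (e - 0) * (deriv (x 0) t * S e t - deriv (x 0) t * S 0 t))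
        + (3 / 4 * e) * (∫ t in (0 : ℝ)..T, S 0 t * deriv (x 0) t))
        - ∫ t in (0 : ℝ)..T, (stiffness (x e t) (r t e) - stiffness (x 0 t) (r t 0))
            * (deriv (x 0) t * deriv (x 0) t) := by
    rw [← intervalIntegral.integral_const_mul, ← intervalIntegral.integral_const_mul,
      ← intervalIntegral.integral_add (Continuous.intervalIntegrable (by fun_prop) _ _)
        (Continuous.intervalIntegrable (by fun_prop) _ _),
      ← intervalIntegral.integral_add (Continuous.intervalIntegrable (by fun_prop) _ _)
        (Continuous.intervalIntegrable (by fun_prop) _ _),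
      ← intervalIntegral.integral_sub (Continuous.intervalIntegrable (by fun_prop) _ _)
        (Continuous.intervalIntegrable (by fun_prop) _ _)]
    congr 1
    funext t
    ring
  rw [intervalIntegral.integral_neg, w0, z] at b1
  rw [abs_le] at a1 a2 ⊢
  constructor <;> linarith [a1.1, a1.2, a2.1, a2.2]

/-- The antisymmetries about 0 and about mπ compose to the translation by 2mπ. -/
theorem periodic_two_mul_pi_of_antisymm {e v : ℝ} (h0 : 0 ≤ e) (h1 : e ≤ 1 / 2) {x : ℝ → ℝ}
    (hx : IsSolutionIVP (fun x t => F x t e) 0 v x) {m : ℕ} (hm : x (m * Real.pi) = 0) :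
    Function.Periodic x (2 * m * Real.pi) := fun t => by
  have h := hx.antisymm h0 h1 hm (-t)
  rw [hx.odd h0 h1, neg_neg, sub_neg_eq_add, add_comm] at h
  exact h

theorem abs_trace_sub_two_le {m p : ℕ} {ε : ℝ} {E : ℝ → ℝ} {φ : ℝ → ℝ → ℝ} {τ : ℝ → ℝ}
    (H : IsOddFamily m p ε E φ) (Hτ : IsTraceAlong m ε φ τ)
    (hc : Real.cos (m * Real.pi / p) ≠ 1) :
    ∃ C δ : ℝ, 0 < δ ∧ ∀ e ∈ Ico 0 δ, |τ e - 2| ≤ C * e ^ 2 := by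
  obtain ⟨C₀, δ₀, hδ₀, hE⟩ := exists_abs_sub_le_mul H.eps_pos H.smooth
  set T : ℝ := 2 * m * Real.pi with hTdef
  have hT : 0 ≤ T := by positivity
  have hεpos := H.eps_pos
  choose! ψ₁ ψ₂ hψ₁ hψ₂ hτ using Hτ
  set δ : ℝ := min (min ε δ₀) (1 / 2) with hδdef
  have hδ : 0 < δ := by positivity
  have hδh : δ ≤ 1 / 2 := min_le_right _ _
  have hδε : ∀ {e : ℝ}, e ∈ Ico 0 δ → e ∈ Ico 0 ε := fun he =>
    ⟨he.1, he.2.trans_le ((min_le_left _ _).trans (min_le_left _ _))⟩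
  have hδδ₀ : ∀ {e : ℝ}, e ∈ Ico 0 δ → e ∈ Ico 0 δ₀ := fun he =>
    ⟨he.1, he.2.trans_le ((min_le_left _ _).trans (min_le_right _ _))⟩
  have hz : (0 : ℝ) ∈ Ico 0 δ := ⟨le_rfl, hδ⟩
  set x : ℝ → ℝ → ℝ := fun e t => φ t e with hxdef
  have hx : ∀ e ∈ Ico 0 δ, IsSolutionIVP (fun x t => F x t e) 0 (E e) (x e) := fun e he =>
    H.solution e (hδε he)
  have hper : ∀ e ∈ Ico 0 δ, Function.Periodic (x e) T := fun e he =>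
    periodic_two_mul_pi_of_antisymm he.1 (he.2.le.trans hδh) (hx e he) (H.boundary e (hδε he))
  have hxT : ∀ e ∈ Ico 0 δ, x e T = 0 := fun e he => by
    have := hper e he 0
    rwa [zero_add, (hx e he).init_pos] at this
  obtain ⟨hl, hl'⟩ := LipAtZero.solution (T := T) (K := 256) (C := max C₀ 0) (by norm_num) hδ
    (fun e he => abs_F_sub_le he.1 (he.2.le.trans hδh)) hx
    (fun e he => by simpa using mul_nonneg (le_max_right C₀ 0) he.1)
    (fun e he => (hE e (hδδ₀ he)).trans
      (mul_le_mul_of_nonneg_right (le_max_left _ _) he.1))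
    (LipAtZero.const (hx 0 hz).continuous).force
  have cq : ∀ e ∈ Ico 0 δ, Continuous fun t => stiffness (x e t) (r t e) := fun e he =>
    continuous_stiffness_comp (hx e he).continuous (continuous_r he.1 (by linarith [he.2]))
      fun t => by linarith [one_fourth_le_r he.1 (he.2.le.trans hδh) t]
  have hpot : ∀ e ∈ Ico 0 δ, potential φ e = fun t => stiffness (x e t) (r t e) := fun e he =>
    funext (potential_eq he.1 (he.2.le.trans hδh))
  have hq : ∀ e ∈ Ico 0 δ, ∀ t, |stiffness (x e t) (r t e)| ≤ 256 := fun e he t =>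
    abs_stiffness_le (one_fourth_le_r he.1 (he.2.le.trans hδh) t)
  have hψ₁' : ∀ e ∈ Ico 0 δ,
      IsSolutionIVP (fun y t => stiffness (x e t) (r t e) * y) 1 0 (ψ₁ e) := fun e he => by
    have := hψ₁ e (hδε he)
    rwa [hpot e he] at this
  have hψ₂' : ∀ e ∈ Ico 0 δ,
      IsSolutionIVP (fun y t => stiffness (x e t) (r t e) * y) 0 1 (ψ₂ e) := fun e he => by
    have := hψ₂ e (hδε he)
    rwa [hpot e he] at this
  have lψ₁ := (LipAtZero.solution (T := T) (K := 256) (C := 0) (by norm_num) hδ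
    (fun e he => abs_mul_sub_mul_le (hq e he)) (a := fun _ => 1) (v := fun _ => 0) hψ₁'
    (by simp) (by simp) (hl.stiffness.mul (LipAtZero.const (hψ₁' 0 hz).continuous))).1
  have lψ₂ := (LipAtZero.solution (T := T) (K := 256) (C := 0) (by norm_num) hδ
    (fun e he => abs_mul_sub_mul_le (hq e he)) (a := fun _ => 0) (v := fun _ => 1) hψ₂'
    (by simp) (by simp) (hl.stiffness.mul (LipAtZero.const (hψ₂' 0 hz).continuous))).1
  have hE0 := H.velocity_pos
  have hv0 := (hx 0 hz).deriv_solution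
  have hq0 : ∀ t, stiffness (x 0 t) (r t 0) = stiffness (x 0 t) (1 / 2) := fun t => by
    rw [r_zero_right]
  -- The velocity solves the linearization with initial data (E(0), 0).
  have hψv : ψ₁ 0 = fun t => (E 0)⁻¹ * deriv (x 0) t := by
    have h := hv0.linear_comb hv0 (E 0)⁻¹ 0
    have h2 := hψ₁' 0 hz
    simp only [hq0] at h2
    have h3 := h2.ext_of_eq_at (t₀ := 0)
      (abs_mul_sub_mul_le fun t => abs_stiffness_le (by norm_num)) h
      (by rw [h2.init_pos, h.init_pos]; field_simp; ring)
      (by rw [h2.init_vel, h.init_vel]; ring)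
    rw [h3]
    funext t
    ring
  have hd1 : deriv (x 0) T = E 0 := by
    rw [← (hx 0 hz).init_vel]
    have := (hper 0 hz)
    have h2 : (fun t => x 0 (t + T)) = x 0 := funext this
    have h3 := deriv_comp_add_const (x 0) T 0
    rw [h2, zero_add] at h3
    exact h3.symm
  have hd2 : deriv (ψ₁ 0) T = 0 := by
    rw [hψv, (((hx 0 hz).equation T).const_mul _).deriv, hxT 0 hz, F_zero_left]
    simp
  have hψT : ψ₁ 0 T = 1 := by
    rw [hψv]
    simp only [hd1]
    field_simp
  have hP := (hx 0 hz).antiperiodic (P := m * Real.pi / p) (by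
    have := H.minimal_period
    convert! this using 1
    ring)
  have hcT : Function.Periodic Real.cos T := by
    have := Real.cos_periodic.nat_mul m
    rwa [show (m : ℝ) * (2 * Real.pi) = T by rw [hTdef]; ring] at this
  have hsT : Function.Periodic Real.sin T := by
    have := Real.sin_periodic.nat_mul m
    rwa [show (m : ℝ) * (2 * Real.pi) = T by rw [hTdef]; ring] at this
  obtain ⟨C₁, δ₁, hδ₁, h1⟩ := integral_potential_sub_le hδ hδh hT hx hxT hl hl' hP (hper 0 hz)
    hcT hsT hc
  obtain ⟨C₂, δ₂, hδ₂, h2⟩ := LipAtZero.integral_sub_mul_sub_le hT hl.stiffness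
    ((LipAtZero.const (hψ₁' 0 hz).continuous).mul lψ₁)
  -- At e = 0 the second family is ψ₁ψ₂ - ψ₂ψ₁ = 0, so this term is of second order without any
  -- averaging.
  obtain ⟨C₃, δ₃, hδ₃, h3⟩ := LipAtZero.integral_sub_mul_sub_le hT hl.stiffness
    (((LipAtZero.const (hψ₁' 0 hz).continuous).mul lψ₂).add
      (((LipAtZero.const (hψ₂' 0 hz).continuous).mul lψ₁).const_mul (-1)))
  refine ⟨|ψ₂ 0 T| * (C₂ + (E 0)⁻¹ ^ 2 * C₁) + C₃, min δ (min δ₁ (min δ₂ δ₃)), by positivity,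
    fun e he => ?_⟩
  simp only [mem_Ico, lt_min_iff] at he
  obtain ⟨hge, heδ, he1, he2, he3⟩ := he
  have he : e ∈ Ico 0 δ := ⟨hge, heδ⟩
  have a1 := h1 e ⟨hge, he1⟩
  have a2 := h2 e ⟨hge, he2⟩
  have a3 := h3 e ⟨hge, he3⟩
  have hform := trace_sub_two (T := T) (cq 0 hz) (cq e he) (hψ₁' 0 hz) (hψ₂' 0 hz) (hψ₁' e he)
    (hψ₂' e he) hψT hd2
  rw [← hτ e (hδε he)] at hform
  have c1 := (hψ₁' 0 hz).continuous
  have c2 := (hψ₁' e he).continuous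
  have c3 := (hψ₂' 0 hz).continuous
  have c4 := (hψ₂' e he).continuous
  have c5 := cq 0 hz
  have c6 := cq e he
  have c7 := (hx 0 hz).continuous_deriv
  have i1 : ∫ t in (0 : ℝ)..T, (stiffness (x 0 t) (r t 0) - stiffness (x e t) (r t e))
        * (ψ₁ 0 t * ψ₁ e t)
      = -(∫ t in (0 : ℝ)..T, (stiffness (x e t) (r t e) - stiffness (x 0 t) (r t 0))
        * (ψ₁ 0 t * ψ₁ e t - ψ₁ 0 t * ψ₁ 0 t))
        - (E 0)⁻¹ ^ 2 * ∫ t in (0 : ℝ)..T,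
          (stiffness (x e t) (r t e) - stiffness (x 0 t) (r t 0))
            * (deriv (x 0) t * deriv (x 0) t) := by
    rw [← intervalIntegral.integral_const_mul, ← intervalIntegral.integral_neg,
      ← intervalIntegral.integral_sub (Continuous.intervalIntegrable (by fun_prop) _ _)
        (Continuous.intervalIntegrable (by fun_prop) _ _)]
    congr 1
    funext t
    rw [show ψ₁ 0 t = (E 0)⁻¹ * deriv (x 0) t from congrFun hψv t]
    ring
  have i2 : ∫ t in (0 : ℝ)..T, (stiffness (x 0 t) (r t 0) - stiffness (x e t) (r t e))
        * (ψ₁ 0 t * ψ₂ e t - ψ₂ 0 t * ψ₁ e t)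
      = -(∫ t in (0 : ℝ)..T, (stiffness (x e t) (r t e) - stiffness (x 0 t) (r t 0))
        * (ψ₁ 0 t * ψ₂ e t + -1 * (ψ₂ 0 t * ψ₁ e t)
          - (ψ₁ 0 t * ψ₂ 0 t + -1 * (ψ₂ 0 t * ψ₁ 0 t)))) := by
    rw [← intervalIntegral.integral_neg]
    congr 1
    funext t
    ring
  rw [hform, i1, i2]
  have hE2 : 0 ≤ (E 0)⁻¹ ^ 2 := by positivity
  set A₁ := ∫ t in (0 : ℝ)..T, (stiffness (x e t) (r t e) - stiffness (x 0 t) (r t 0))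
    * (deriv (x 0) t * deriv (x 0) t)
  set A₂ := ∫ t in (0 : ℝ)..T, (stiffness (x e t) (r t e) - stiffness (x 0 t) (r t 0))
    * (ψ₁ 0 t * ψ₁ e t - ψ₁ 0 t * ψ₁ 0 t)
  set A₃ := ∫ t in (0 : ℝ)..T, (stiffness (x e t) (r t e) - stiffness (x 0 t) (r t 0))
        * (ψ₁ 0 t * ψ₂ e t + -1 * (ψ₂ 0 t * ψ₁ e t)
          - (ψ₁ 0 t * ψ₂ 0 t + -1 * (ψ₂ 0 t * ψ₁ 0 t)))
  have n1 : |-A₂ - (E 0)⁻¹ ^ 2 * A₁| ≤ (C₂ + (E 0)⁻¹ ^ 2 * C₁) * e ^ 2 := by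
    refine (abs_sub _ _).trans ?_
    rw [abs_neg, abs_mul, abs_of_nonneg hE2]
    nlinarith [mul_le_mul_of_nonneg_left a1 hE2]
  refine (abs_add_le _ _).trans ?_
  rw [abs_mul, abs_neg]
  nlinarith [mul_le_mul_of_nonneg_left n1 (abs_nonneg (ψ₂ 0 T))]

theorem hasDerivWithinAt_of_abs_sub_le {τ : ℝ → ℝ} {a C δ : ℝ} (hδ : 0 < δ)
    (h : ∀ e ∈ Ico 0 δ, |τ e - a| ≤ C * e ^ 2) : HasDerivWithinAt τ 0 (Ici 0) 0 := by
  have h0 : τ 0 = a := by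
    have := h 0 ⟨le_rfl, hδ⟩
    rw [zero_pow two_ne_zero, mul_zero] at this
    linarith [abs_nonpos_iff.1 this]
  rw [hasDerivWithinAt_iff_isLittleO, h0]
  have h1 : (fun e => τ e - a) =O[nhdsWithin 0 (Ici 0)] fun e => e ^ 2 := by
    refine Asymptotics.IsBigO.of_bound C ?_
    filter_upwards [Ico_mem_nhdsGE hδ] with e he
    simpa using h e he
  have h2 : (fun e : ℝ => e ^ 2) =o[nhdsWithin 0 (Ici 0)] fun e => e :=
    (Asymptotics.isLittleO_pow_id one_lt_two).mono nhdsWithin_le_nhds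
  simpa using h1.trans_isLittleO h2

/-- Resonance means that half of the minimal period, mπ/p, equals 2πn, that is m = 2np. -/
theorem cos_ne_one_of_ratio_ne {m p : ℕ} (hm : m ≠ 0) (hp : p ≠ 0)
    (h : ∀ n : ℕ, 1 ≤ n → (p : ℝ) / (m : ℝ) ≠ 1 / (2 * (n : ℝ))) :
    Real.cos (m * Real.pi / p) ≠ 1 := by
  intro hc
  obtain ⟨n, hn⟩ := (Real.cos_eq_one_iff _).1 hc
  have hm' : (0 : ℝ) < m := by positivity
  have hp' : (0 : ℝ) < p := by positivity
  have h1 : (m : ℝ) = 2 * n * p := by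
    have := Real.pi_pos
    field_simp at hn
    nlinarith
  have hn0 : 0 < n := by
    by_contra! hle
    have : (n : ℝ) ≤ 0 := by exact_mod_cast hle
    nlinarith
  lift n to ℕ using hn0.le
  refine h n (by omega) ?_
  have hn' : (0 : ℝ) < n := by exact_mod_cast hn0
  rw [h1]
  push_cast
  field_simp

theorem traceDerivVanishes_of_ratio_ne {m p : ℕ} (hm : m ≠ 0) (hp : p ≠ 0)
    (h : ∀ n : ℕ, 1 ≤ n → (p : ℝ) / (m : ℝ) ≠ 1 / (2 * (n : ℝ))) : TraceDerivVanishes m p := by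
  intro ε E φ τ H Hτ
  obtain ⟨C, δ, hδ, hC⟩ := abs_trace_sub_two_le H Hτ (cos_ne_one_of_ratio_ne hm hp h)
  exact hasDerivWithinAt_of_abs_sub_le hδ hC

/-! ### Periodic solutions of the circular problem -/

theorem invDist_anti {x y : ℝ} (hx : 0 ≤ x) (hxy : x ≤ y) :
    invDist y (1 / 2) ≤ invDist x (1 / 2) := by
  unfold invDist
  gcongr

theorem monotoneOn_of_hasDerivAt_nonneg {f f' : ℝ → ℝ} {a b : ℝ} (hf : ∀ t, HasDerivAt f (f' t) t)
    (h : ∀ t ∈ Ioo a b, 0 ≤ f' t) : MonotoneOn f (Icc a b) := by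
  refine monotoneOn_of_deriv_nonneg (convex_Icc a b)
    (fun t _ => (hf t).continuousAt.continuousWithinAt)
    (fun t _ => (hf t).differentiableAt.differentiableWithinAt) fun t ht => ?_
  rw [interior_Icc] at ht
  rw [(hf t).deriv]
  exact h t ht

theorem strictMonoOn_of_hasDerivAt_pos {f f' : ℝ → ℝ} {a b : ℝ} (hf : ∀ t, HasDerivAt f (f' t) t)
    (h : ∀ t ∈ Ioo a b, 0 < f' t) : StrictMonoOn f (Icc a b) := by
  refine strictMonoOn_of_deriv_pos (convex_Icc a b)
    (fun t _ => (hf t).continuousAt.continuousWithinAt) fun t ht => ?_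
  rw [interior_Icc] at ht
  rw [(hf t).deriv]
  exact h t ht

/-! ### Shooting for the quarter period of the circular problem -/

section Quarter

variable {σ η : ℝ} {x : ℝ → ℝ}

/-- While the velocity is nonnegative, x ≥ 0 and the velocity does not increase. A zero before σ
would keep it zero up to σ; then the force and x vanish there too, and energy conservation gives η =
0. -/
theorem IsSolutionIVP.deriv_pos_of_nonneg (hx : IsSolutionIVP (fun x t => F x t 0) 0 η x)
    (hη : η ≠ 0) (h : ∀ t ∈ Icc 0 σ, 0 ≤ deriv x t) : ∀ t ∈ Ico 0 σ, 0 < deriv x t := by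
  intro t ht
  refine lt_of_le_of_ne (h t ⟨ht.1, ht.2.le⟩) fun hzero => ?_
  have hmono := monotoneOn_of_hasDerivAt_nonneg (a := 0) (b := σ) hx.hasDerivAt
    fun s hs => h s ⟨hs.1.le, hs.2.le⟩
  have hx0 : ∀ s ∈ Icc 0 σ, 0 ≤ x s := fun s hs => by
    have := hmono ⟨le_rfl, hs.1.trans hs.2⟩ hs hs.1
    rwa [hx.init_pos] at this
  have hF : ∀ s ∈ Icc 0 σ, 0 ≤ F (x s) s 0 := fun s hs => by
    rw [F_zero_right]
    exact mul_nonneg (hx0 s hs) (pow_pos (invDist_pos (by norm_num)) 3).le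
  have hanti := monotoneOn_of_hasDerivAt_nonneg (a := 0) (b := σ) (f := fun s => -deriv x s)
    (f' := fun s => F (x s) s 0) (fun s => by
      convert! (hx.equation s).neg using 1
      rw [neg_neg])
    fun s hs => hF s ⟨hs.1.le, hs.2.le⟩
  have hz : ∀ s ∈ Icc t σ, deriv x s = 0 := fun s hs => by
    have h1 := hanti ⟨ht.1, ht.2.le⟩ ⟨ht.1.trans hs.1, hs.2⟩ hs.1
    have h2 := h s ⟨ht.1.trans hs.1, hs.2⟩
    simp only at h1
    linarith
  set s := (t + σ) / 2 with hs
  have hs1 : s ∈ Ioo t σ := ⟨by linarith [ht.2], by linarith [ht.2]⟩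
  have h1 : HasDerivAt (deriv x) 0 s := by
    refine (hasDerivAt_const s (0 : ℝ)).congr_of_eventuallyEq ?_
    filter_upwards [Ioo_mem_nhds hs1.1 hs1.2] with u hu
    exact hz u ⟨hu.1.le, hu.2.le⟩
  have h2 := (hx.equation s).unique h1
  have h3 : x s = 0 := by
    rw [F_zero_right, neg_eq_zero, mul_eq_zero] at h2
    exact h2.resolve_right (pow_pos (invDist_pos (by norm_num)) 3).ne'
  have h4 := hx.energy s
  have h5 := hx.energy 0
  rw [hz s ⟨hs1.1.le, hs1.2.le⟩, h3] at h4
  rw [hx.init_pos, hx.init_vel] at h5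
  have : η ^ 2 = 0 := by linarith
  exact hη (pow_eq_zero_iff two_ne_zero |>.1 this)

theorem IsSolutionIVP.pos_of_deriv_pos (hx : IsSolutionIVP (fun x t => F x t 0) 0 η x)
    (h : ∀ t ∈ Ico 0 σ, 0 < deriv x t) : ∀ t ∈ Ioc 0 σ, 0 < x t := by
  intro t ht
  have := strictMonoOn_of_hasDerivAt_pos (a := 0) (b := σ) hx.hasDerivAt
    (fun s hs => h s ⟨hs.1.le, hs.2⟩) ⟨le_rfl, ht.1.le.trans ht.2⟩ ⟨ht.1.le, ht.2⟩ ht.1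
  rwa [hx.init_pos] at this

/-- A slow solution turns back before time `σ`, if `σ` exceeds the quarter period `π / (2√8)` of
the linearization at the origin. -/
theorem exists_small_velocity (hσ : 0 < σ) (hσ8 : (Real.pi / (2 * σ)) ^ 2 < 8) :
    ∃ η₀ : ℝ, 0 < η₀ ∧ η₀ ≤ 2 ∧ ∀ x, IsSolutionIVP (fun x t => F x t 0) 0 η₀ x →
      ∃ t ∈ Icc 0 σ, deriv x t < 0 := by
  -- The function sin(at) has quarter period σ, and a² < 8 = w³ at the origin.
  set a := Real.pi / (2 * σ) with ha
  have ha0 : 0 < a := by have := Real.pi_pos; positivity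
  have haσ : a * σ = Real.pi / 2 := by rw [ha]; field_simp
  have hcont : Continuous fun η : ℝ => invDist (η * σ) (1 / 2) ^ 3 :=
    (continuous_invDist_comp (by fun_prop) continuous_const fun _ => by norm_num).pow 3
  have h0 : a ^ 2 < invDist (0 * σ) (1 / 2) ^ 3 := by
    rw [zero_mul, invDist_eq_of_sq_mul (w := 2) (by norm_num) (by norm_num)]
    linarith
  have hev : ∀ᶠ η in nhdsWithin (0 : ℝ) (Ioi 0), a ^ 2 < invDist (η * σ) (1 / 2) ^ 3 :=
    nhdsWithin_le_nhds (hcont.continuousAt.eventually_const_lt h0)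
  obtain ⟨η₀, h1, h2⟩ := (hev.and (Ioc_mem_nhdsGT (by norm_num : (0 : ℝ) < 2))).exists
  refine ⟨η₀, h2.1, h2.2, fun x hx => ?_⟩
  by_contra! hcon
  have hpos := hx.deriv_pos_of_nonneg h2.1.ne' hcon
  have hxpos := hx.pos_of_deriv_pos hpos
  have hanti := monotoneOn_of_hasDerivAt_nonneg (a := 0) (b := σ) (f := fun s => -deriv x s)
    (f' := fun s => F (x s) s 0) (fun s => by
      convert! (hx.equation s).neg using 1
      rw [neg_neg])
    fun s hs => (F_zero_right_pos (hxpos s ⟨hs.1, hs.2.le⟩) s).le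
  have hle : ∀ t ∈ Icc 0 σ, x t ≤ η₀ * σ := fun t ht => by
    have := monotoneOn_of_hasDerivAt_nonneg (a := 0) (b := σ) (f := fun t => η₀ * t - x t)
      (f' := fun t => η₀ * 1 - deriv x t)
      (fun t => ((hasDerivAt_id t).const_mul η₀).sub (hx.hasDerivAt t)) (fun s hs => by
        have := hanti ⟨le_rfl, hσ.le⟩ ⟨hs.1.le, hs.2.le⟩ hs.1.le
        simp only [hx.init_vel] at this
        linarith) ⟨le_rfl, hσ.le⟩ ht ht.1
    simp only [hx.init_pos] at this
    have h4 : η₀ * t ≤ η₀ * σ := mul_le_mul_of_nonneg_left ht.2 h2.1.le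
    linarith
  -- Sturm comparison with sin(at): x ≤ η₀σ keeps w³ above a², so this Wronskian increases from 0 to
  -- -x'(σ), which makes x'(σ) negative.
  have hW := strictMonoOn_of_hasDerivAt_pos (a := 0) (b := σ)
    (f := fun t => a * x t * Real.cos (a * t) - deriv x t * Real.sin (a * t))
    (f' := fun t => (x t * (invDist (x t) (1 / 2) ^ 3 - a ^ 2)) * Real.sin (a * t))
    (fun t => by
      have hat : HasDerivAt (fun t : ℝ => a * t) a t := by
        simpa using (hasDerivAt_id t).const_mul a
      convert! (((hx.hasDerivAt t).const_mul a).mul hat.cos).sub ((hx.equation t).mul hat.sin)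
        using 1
      rw [F_zero_right]
      ring)
    (fun t ht => by
      have hxt := hxpos t ⟨ht.1, ht.2.le⟩
      have h3 := invDist_anti hxt.le (hle t ⟨ht.1.le, ht.2.le⟩)
      have h4 : invDist (η₀ * σ) (1 / 2) ^ 3 ≤ invDist (x t) (1 / 2) ^ 3 := by
        have := (invDist_pos (x := η₀ * σ) (ρ := 1 / 2) (by norm_num)).le
        gcongr
      have h5 : 0 < Real.sin (a * t) := Real.sin_pos_of_pos_of_lt_pi (mul_pos ha0 ht.1) (by
        have : a * t < a * σ := by have := ht.2; gcongr
        linarith [Real.pi_pos])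
      exact mul_pos (mul_pos hxt (by linarith)) h5)
    ⟨le_rfl, hσ.le⟩ ⟨hσ.le, le_rfl⟩ hσ
  simp only [hx.init_pos, haσ, Real.cos_pi_div_two, Real.sin_pi_div_two, mul_zero, Real.sin_zero] at hW
  linarith [hcon σ ⟨hσ.le, le_rfl⟩]

/-- The energy is 0 for η = 2, whereas at a turning point it would be -w < 0. -/
theorem IsSolutionIVP.deriv_pos_of_escape (hx : IsSolutionIVP (fun x t => F x t 0) 0 2 x)
    (t : ℝ) (ht : 0 ≤ t) : 0 < deriv x t := by
  by_contra! hle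
  have h0 : deriv x 0 = 2 := hx.init_vel
  obtain ⟨s, -, hs⟩ := intermediate_value_Icc' ht hx.continuous_deriv.continuousOn
    (show (0 : ℝ) ∈ Icc (deriv x t) (deriv x 0) from ⟨hle, by rw [h0]; norm_num⟩)
  have h1 := hx.energy s
  rw [hs] at h1
  have := invDist_pos (x := x s) (ρ := 1 / 2) (by norm_num)
  linarith

/-- For every `σ > π / (2√8)` there is a solution of the circular problem that increases on
`[0, σ]` and has its first turning point at time `σ`. -/
theorem exists_quarter_solution (hσ : 0 < σ) (hσ8 : (Real.pi / (2 * σ)) ^ 2 < 8) :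
    ∃ η x, 0 < η ∧ IsSolutionIVP (fun x t => F x t 0) 0 η x ∧ deriv x σ = 0 ∧
      ∀ t ∈ Ico 0 σ, 0 < deriv x t := by
  choose X hX using exists_solution_F (e := 0) le_rfl (by norm_num)
  have hdep : ∀ η η', ∀ t ∈ Icc 0 σ,
      |deriv (X η) t - deriv (X η') t| ≤ |η - η'| * Real.exp (256 * σ) := fun η η' t ht => by
    have := ((hX η).abs_sub_le (δ := |η - η'|) (ε := 0) (by norm_num)
      (abs_F_sub_le le_rfl (by norm_num)) (hX η') le_rfl (by simp) (by simp) le_rfl t ht).2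
    rwa [add_zero] at this
  have hexp := Real.exp_pos (256 * σ)
  obtain ⟨η₀, hη₀, hη₀2, hsmall⟩ := exists_small_velocity hσ hσ8
  have o1 : IsOpen {η | ∀ t ∈ Icc 0 σ, 0 < deriv (X η) t} := by
    rw [Metric.isOpen_iff]
    intro η hη
    obtain ⟨s, hs, hmin⟩ := isCompact_Icc.exists_isMinOn (nonempty_Icc.2 hσ.le)
      (hX η).continuous_deriv.continuousOn
    refine ⟨deriv (X η) s / Real.exp (256 * σ), div_pos (hη s hs) hexp, fun η' hη' t ht => ?_⟩
    rw [Metric.mem_ball, Real.dist_eq, lt_div_iff₀ hexp] at hη'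
    have h1 := hdep η' η t ht
    have h2 := isMinOn_iff.1 hmin t ht
    linarith [(abs_le.1 h1).1]
  have o2 : IsOpen {η | ∃ t ∈ Icc 0 σ, deriv (X η) t < 0} := by
    rw [Metric.isOpen_iff]
    rintro η ⟨s, hs, hlt⟩
    refine ⟨-deriv (X η) s / Real.exp (256 * σ), div_pos (by linarith) hexp,
      fun η' hη' => ⟨s, hs, ?_⟩⟩
    rw [Metric.mem_ball, Real.dist_eq, lt_div_iff₀ hexp] at hη'
    linarith [(abs_le.1 (hdep η' η s hs)).2]
  -- The two sets are open and disjoint, and each meets the connected interval. So some η lies in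
  -- neither: its velocity is nonnegative with a zero, which can only be at σ.
  have hcover : ¬ Icc η₀ 2 ⊆ {η | ∀ t ∈ Icc 0 σ, 0 < deriv (X η) t} ∪
      {η | ∃ t ∈ Icc 0 σ, deriv (X η) t < 0} := fun hsub => by
    obtain ⟨η, -, h1, t, ht, h2⟩ := isPreconnected_Icc _ _ o1 o2 hsub
      ⟨2, ⟨hη₀2, le_rfl⟩, fun t ht => (hX 2).deriv_pos_of_escape t ht.1⟩
      ⟨η₀, ⟨le_rfl, hη₀2⟩, hsmall _ (hX η₀)⟩
    linarith [h1 t ht]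
  obtain ⟨η, hη, hnot⟩ := not_subset.1 hcover
  simp only [mem_union, mem_ofPred_eq, not_or, not_forall, not_exists, not_and, not_lt] at hnot
  obtain ⟨⟨t, ht, hle⟩, hnn⟩ := hnot
  have hη0 : 0 < η := hη₀.trans_le hη.1
  have hpos := (hX η).deriv_pos_of_nonneg hη0.ne' hnn
  refine ⟨η, X η, hη0, hX η, ?_, hpos⟩
  have htσ : t = σ := by
    by_contra hne
    linarith [hpos t ⟨ht.1, lt_of_le_of_ne ht.2 hne⟩]
  subst htσ
  exact le_antisymm hle (hnn t ht)

theorem IsSolutionIVP.symm_of_deriv_eq_zero (hx : IsSolutionIVP (fun x t => F x t 0) 0 η x)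
    (h : deriv x σ = 0) (t : ℝ) : x (2 * σ - t) = x t := by
  have hneg : ∀ t : ℝ, HasDerivAt (fun t : ℝ => 2 * σ - t) (-1) t := fun t => by
    simpa using (hasDerivAt_id t).const_sub (2 * σ)
  have hd : ∀ t, HasDerivAt (fun t => x (2 * σ - t)) (-deriv x (2 * σ - t)) t :=
    fun t => by
      convert! (hx.hasDerivAt (2 * σ - t)).comp t (hneg t) using 1
      ring
  have h1 := IsSolutionIVP.of_hasDerivAt (g := fun x t => F x t 0) hd
    (fun t => by
      convert! ((hx.equation (2 * σ - t)).comp t (hneg t)).neg using 1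
      rw [F_zero_right, F_zero_right]
      ring)
  have e1 : 2 * σ - σ = σ := by ring
  have h2 := hx.ext_of_eq_at (abs_F_sub_le le_rfl (by norm_num)) h1 (t₀ := σ)
    (by simp only [e1]) (by rw [(hd _).deriv, e1, h, neg_zero])
  exact (congrFun h2 t).symm

/-- The reflection in the turning point σ, combined with oddness, is the shift by 2σ. -/
theorem IsSolutionIVP.antiperiodic_of_deriv_eq_zero
    (hx : IsSolutionIVP (fun x t => F x t 0) 0 η x) (h : deriv x σ = 0) (t : ℝ) :
    x (t + 2 * σ) = -x t := by
  rw [← hx.odd le_rfl (by norm_num), ← hx.symm_of_deriv_eq_zero h (-t)]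
  congr 1
  ring

theorem IsSolutionIVP.pos_on_half_period (hx : IsSolutionIVP (fun x t => F x t 0) 0 η x)
    (h : deriv x σ = 0) (hpos : ∀ t ∈ Ico 0 σ, 0 < deriv x t) :
    ∀ t ∈ Ioo 0 (2 * σ), 0 < x t := by
  intro t ht
  rcases le_total t σ with hle | hle
  · exact hx.pos_of_deriv_pos hpos t ⟨ht.1, hle⟩
  · rw [← hx.symm_of_deriv_eq_zero h]
    exact hx.pos_of_deriv_pos hpos _ ⟨by linarith [ht.2], by linarith⟩

end Quarter

/-! ### Minimal period and nondegeneracy of the circular solution -/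

section HalfPeriod

variable {S η : ℝ} {x : ℝ → ℝ}

theorem deriv_of_antiperiodic (hS : ∀ t, x (t + S) = -x t) (t : ℝ) :
    deriv x (t + S) = -deriv x t := by
  rw [← deriv_comp_add_const, funext hS, deriv.fun_neg]

/-- A smaller period would be a zero of x in (0, 2S). The only one is S, where the velocity is -η
instead of η. -/
theorem IsSolutionIVP.isMinimalPeriod (hx : IsSolutionIVP (fun x t => F x t 0) 0 η x)
    (hη : 0 < η) (hS0 : 0 < S) (hS : ∀ t, x (t + S) = -x t) (hpos : ∀ t ∈ Ioo 0 S, 0 < x t) :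
    IsMinimalPeriod x (2 * S) := by
  refine ⟨⟨by linarith, fun t => ?_⟩, fun s hs => ?_⟩
  · rw [two_mul, ← add_assoc, hS, hS, neg_neg]
  · by_contra! hlt
    obtain ⟨hs0, hs⟩ := hs
    have hxs : x s = 0 := by
      have := hs 0
      rwa [zero_add, hx.init_pos] at this
    rcases lt_trichotomy s S with h | h | h
    · exact (hpos s ⟨hs0, h⟩).ne' hxs
    · subst h
      have h1 := deriv_of_antiperiodic hS 0
      have h2 : deriv x (0 + s) = deriv x 0 := by
        rw [← deriv_comp_add_const, funext hs]
      rw [h2, hx.init_vel] at h1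
      linarith
    · have h1 := hS (s - S)
      rw [sub_add_cancel, hxs] at h1
      linarith [hpos (s - S) ⟨by linarith, by linarith⟩]

/-- Sturm comparison of the linearization with the equation `x'' + w³ x = 0`: the solution of the
linearized problem does not vanish on `(0, S]`. -/
theorem linearized_pos (hx : IsSolutionIVP (fun x t => F x t 0) 0 η x) (hη : 0 < η) (hS0 : 0 < S)
    (hS : ∀ t, x (t + S) = -x t) (hpos : ∀ t ∈ Ioo 0 S, 0 < x t) {ψ : ℝ → ℝ}
    (hψ : IsSolutionIVP (fun y t => stiffness (x t) (1 / 2) * y) 0 1 ψ) : 0 < ψ S := by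
  by_contra! hle
  obtain ⟨δ, hδ, hδ'⟩ : ∃ δ > 0, ∀ t, |t| < δ → 0 < deriv ψ t := by
    have h1 := hψ.continuous_deriv.continuousAt.eventually_const_lt
      (show (0 : ℝ) < deriv ψ 0 by rw [hψ.init_vel]; exact one_pos)
    obtain ⟨δ, hδ, h⟩ := Metric.eventually_nhds_iff.1 h1
    exact ⟨δ, hδ, fun t ht => h (by simpa [Real.dist_eq] using ht)⟩
  have hnear : ∀ t, 0 < t → t < δ → 0 < ψ t := fun t ht htδ => by
    have := strictMonoOn_of_hasDerivAt_pos (a := 0) (b := t) hψ.hasDerivAt (fun s hs =>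
      hδ' s (by rw [abs_of_pos hs.1]; linarith [hs.2])) ⟨le_rfl, ht.le⟩ ⟨ht.le, le_rfl⟩ ht
    rwa [hψ.init_pos] at this
  have hδS : δ ≤ S := by
    by_contra! h
    linarith [hnear S hS0 h]
  -- The least element s is the first zero of ψ after 0; starting at δ/2 excludes the zero at 0.
  have hcomp : IsCompact (Icc (δ / 2) S ∩ {t | ψ t ≤ 0}) :=
    isCompact_Icc.inter_right (isClosed_le hψ.continuous continuous_const)
  obtain ⟨s, ⟨hsI, hs0⟩, hsmin⟩ := hcomp.exists_isLeast ⟨S, ⟨by linarith, le_rfl⟩, hle⟩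
  have hspos : 0 < s := by linarith [hsI.1]
  have hψpos : ∀ t ∈ Ioo 0 s, 0 < ψ t := fun t ht => by
    rcases lt_or_ge t δ with h | h
    · exact hnear t ht.1 h
    · by_contra! hcon
      have := hsmin ⟨⟨by linarith, ht.2.le.trans hsI.2⟩, hcon⟩
      linarith [ht.2]
  -- The Wronskian xψ' - x'ψ increases from 0. At s = S it equals ηψ(S) ≤ 0, a contradiction; for s
  -- < S it gives ψ'(s) > 0, although ψ falls to 0 from positive values.
  have hW := strictMonoOn_of_hasDerivAt_pos (a := 0) (b := s)
    (f := fun t => x t * deriv ψ t - deriv x t * ψ t)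
    (f' := fun t => x t * ψ t * (3 * x t ^ 2 * invDist (x t) (1 / 2) ^ 5))
    (fun t => by
      convert! ((hx.hasDerivAt t).mul (hψ.equation t)).sub ((hx.equation t).mul (hψ.hasDerivAt t))
        using 1
      rw [F_zero_right, stiffness]
      ring)
    (fun t ht => by
      have h1 := hpos t ⟨ht.1, ht.2.trans_le hsI.2⟩
      have h2 := hψpos t ht
      have h3 := invDist_pos (x := x t) (ρ := 1 / 2) (by norm_num)
      positivity)
    ⟨le_rfl, hspos.le⟩ ⟨hspos.le, le_rfl⟩ hspos
  simp only [hx.init_pos, hψ.init_pos, mul_zero, zero_mul, sub_zero] at hW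
  rcases eq_or_lt_of_le hsI.2 with h | h
  · have h1 := deriv_of_antiperiodic hS 0
    have h2 := hS 0
    rw [zero_add, hx.init_vel] at h1
    rw [zero_add, hx.init_pos, neg_zero] at h2
    rw [h, h1, h2] at hW
    nlinarith
  · have hxs := hpos s ⟨hspos, h⟩
    have hψs : ψ s = 0 := by
      refine le_antisymm hs0 ?_
      have : s ∈ closure (Ioo 0 s) := by
        rw [closure_Ioo hspos.ne]
        exact ⟨hspos.le, le_rfl⟩
      exact closure_minimal (fun t ht => (hψpos t ht).le)
        (isClosed_le continuous_const hψ.continuous) this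
    rw [hψs, mul_zero, sub_zero] at hW
    have hd : 0 < deriv ψ s := by
      by_contra! hcon
      nlinarith
    have h1 := hψ.continuous_deriv.continuousAt.eventually_const_lt hd
    obtain ⟨ε, hε, hε'⟩ := Metric.eventually_nhds_iff.1 h1
    set u := max (s / 2) (s - ε / 2) with hu
    have hus : u < s := max_lt (by linarith) (by linarith)
    have hu0 : 0 < u := lt_of_lt_of_le (by linarith) (le_max_left _ _)
    have := strictMonoOn_of_hasDerivAt_pos (a := u) (b := s) hψ.hasDerivAt (fun t ht => hε' (by
      have h5 : s - ε / 2 ≤ u := le_max_right _ _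
      rw [Real.dist_eq, abs_lt]
      constructor <;> linarith [ht.1, ht.2])) ⟨le_rfl, hus.le⟩ ⟨hus.le, le_rfl⟩ hus
    linarith [hψpos u ⟨hu0, hus⟩]

theorem stiffness_neg (x ρ : ℝ) : stiffness (-x) ρ = stiffness x ρ := by
  simp [stiffness, invDist]

/-- The linearization along a nonconstant periodic solution of the circular problem has no
nontrivial solution that vanishes at two of its zeros. -/
theorem linearized_ne_zero (hx : IsSolutionIVP (fun x t => F x t 0) 0 η x) (hη : 0 < η)
    (hS0 : 0 < S) (hS : ∀ t, x (t + S) = -x t) (hpos : ∀ t ∈ Ioo 0 S, 0 < x t) {ψ : ℝ → ℝ}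
    (hψ : IsSolutionIVP (fun y t => stiffness (x t) (1 / 2) * y) 0 1 ψ) {k : ℕ} (hk : k ≠ 0) :
    ψ (k * S) ≠ 0 := by
  have hψS := linearized_pos hx hη hS0 hS hpos hψ
  have hv := hx.deriv_solution
  have hxS : x S = 0 := by
    have := hS 0
    rwa [zero_add, hx.init_pos, neg_zero] at this
  have hvS : deriv x S = -η := by
    have := deriv_of_antiperiodic hS 0
    rwa [zero_add, hx.init_vel] at this
  have cq : Continuous fun t => stiffness (x t) (1 / 2) :=
    continuous_stiffness_comp hx.continuous continuous_const fun _ => by norm_num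
  have hdψ : deriv ψ S = -1 := by
    have := integral_wronskian (f := fun _ => 0) hv.hasDerivAt hv.equation hψ.hasDerivAt
      (fun t => by simpa using hψ.equation t) cq cq continuous_const S
    rw [hv.init_pos, hv.init_vel, hψ.init_pos, hψ.init_vel, hvS, (hx.equation S).deriv, hxS,
      F_zero_left] at this
    simp only [sub_self, zero_mul, intervalIntegral.integral_zero] at this
    have h : η * (deriv ψ S + 1) = 0 := by linarith
    linarith [(mul_eq_zero.1 h).resolve_left hη.ne']
  -- The potential has period S, so ψ(· + S) is the solution with data (ψ(S), -1), expanded here in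
  -- ψ and x'. Iteration makes |ψ(kS)| grow linearly in k.
  have hrec : ∀ t, ψ (t + S) = -1 * ψ t + ψ S / η * deriv x t := by
    have h1 := hψ.comp_add_const (s := S) (fun y t => by rw [hS, stiffness_neg])
    have h2 := hψ.linear_comb hv (-1) (ψ S / η)
    exact congrFun (h1.ext_of_eq_at (t₀ := 0)
      (abs_mul_sub_mul_le fun t => abs_stiffness_le (by norm_num)) h2
      (by rw [h1.init_pos, h2.init_pos]; field_simp; ring)
      (by rw [h1.init_vel, h2.init_vel, hdψ]; ring))
  have hind : ∀ k : ℕ, deriv x (k * S) = (-1) ^ k * η ∧ ψ (k * S) = -(-1) ^ k * (k * ψ S) := by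
    intro k
    induction k with
    | zero => simp [hx.init_vel, hψ.init_pos]
    | succ k ih =>
      have e1 : ((k + 1 : ℕ) : ℝ) * S = k * S + S := by push_cast; ring
      rw [e1, deriv_of_antiperiodic hS, hrec, ih.1, ih.2]
      refine ⟨by ring, ?_⟩
      push_cast
      field_simp
      ring
  rw [(hind k).2]
  have hk' : (0 : ℝ) < k := by positivity
  exact mul_ne_zero (neg_ne_zero.2 (pow_ne_zero _ (by norm_num))) (by positivity)

end HalfPeriod

/-! ### The boundary value problem as an equation in a Banach space

The eccentric anomaly is used as the independent variable; this makes the equation polynomial in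
the eccentricity. -/

section Prim

variable {L : ℝ} (hL : 0 ≤ L)

/-- The extension of a continuous function on `[0, L]` by constants. -/
def extendIcc (f : C(Icc (0 : ℝ) L, ℝ)) : ℝ → ℝ := IccExtend hL f

theorem continuous_extendIcc (f : C(Icc (0 : ℝ) L, ℝ)) : Continuous (extendIcc hL f) :=
  f.continuous.Icc_extend'

theorem abs_extendIcc_le (f : C(Icc (0 : ℝ) L, ℝ)) (t : ℝ) : |extendIcc hL f t| ≤ ‖f‖ :=
  f.norm_coe_le_norm _

theorem extendIcc_of_mem (f : C(Icc (0 : ℝ) L, ℝ)) {t : ℝ} (ht : t ∈ Icc 0 L) :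
    extendIcc hL f t = f ⟨t, ht⟩ := IccExtend_of_mem hL f ht

/-- The primitive that vanishes at `0`, as an operator on the continuous functions. -/
def prim : C(Icc (0 : ℝ) L, ℝ) →L[ℝ] C(Icc (0 : ℝ) L, ℝ) :=
  LinearMap.mkContinuous
    { toFun := fun f => ⟨fun t => ∫ s in (0 : ℝ)..t, extendIcc hL f s,
        (intervalIntegral.continuous_primitive
          (fun _ _ => (continuous_extendIcc hL f).intervalIntegrable _ _) 0).comp
          continuous_subtype_val⟩
      map_add' := fun f g => by
        ext t
        exact intervalIntegral.integral_add
          ((continuous_extendIcc hL f).intervalIntegrable _ _)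
          ((continuous_extendIcc hL g).intervalIntegrable _ _)
      map_smul' := fun c f => by
        ext t
        exact intervalIntegral.integral_const_mul c _ } L
    (fun f => by
      rw [ContinuousMap.norm_le _ (by positivity)]
      intro t
      have := intervalIntegral.norm_integral_le_of_norm_le_const (a := 0) (b := (t : ℝ))
        (f := extendIcc hL f) (C := ‖f‖) (fun s _ => abs_extendIcc_le hL f s)
      rw [sub_zero, abs_of_nonneg t.2.1] at this
      refine this.trans ?_
      rw [mul_comm]
      exact mul_le_mul_of_nonneg_right t.2.2 (norm_nonneg f))

theorem prim_apply_eq {f : C(Icc (0 : ℝ) L, ℝ)} {g : ℝ → ℝ} (h : ∀ s : Icc (0 : ℝ) L, f s = g s)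
    (t : Icc (0 : ℝ) L) : prim hL f t = ∫ s in (0 : ℝ)..t, g s := by
  change ∫ s in (0 : ℝ)..t, extendIcc hL f s = _
  refine intervalIntegral.integral_congr fun s hs => ?_
  rw [uIcc_of_le t.2.1] at hs
  have hs' : s ∈ Icc 0 L := ⟨hs.1, hs.2.trans t.2.2⟩
  rw [extendIcc_of_mem hL f hs', h]

/-- The weight `dt/du = 1 - e cos u` of the change of the independent variable. -/
def weight (L e : ℝ) : C(Icc (0 : ℝ) L, ℝ) :=
  1 - e • ⟨fun u => Real.cos u, by fun_prop⟩

theorem weight_apply (e : ℝ) (u : Icc (0 : ℝ) L) : weight L e u = 1 - e * Real.cos u := rfl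

theorem weight_zero : weight L 0 = 1 := by
  rw [weight, zero_smul, sub_zero]

/-- Solves `x'' = -f` as a function of the eccentric anomaly. -/
def doublePrim (f : ℝ → ℝ) (e η u : ℝ) : ℝ :=
  ∫ s in (0 : ℝ)..u, (1 - e * Real.cos s) * (η - ∫ σ in (0 : ℝ)..s, (1 - e * Real.cos σ) * f σ)

theorem prim_prim_apply (f : C(Icc (0 : ℝ) L, ℝ)) (e η : ℝ) (u : Icc (0 : ℝ) L) :
    prim hL (weight L e * (η • (1 : C(Icc (0 : ℝ) L, ℝ)) - prim hL (weight L e * f))) u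
      = doublePrim (extendIcc hL f) e η u := by
  refine prim_apply_eq hL (fun s => ?_) u
  rw [← prim_apply_eq hL (f := weight L e * f) (fun s => ?_) s]
  · simp [weight_apply]
  · rw [ContinuousMap.mul_apply, weight_apply, extendIcc_of_mem hL f s.2]

/-- Since du/dt = 1/(1 - e cos u), the chain rule cancels both weights of the double integral. -/
theorem isSolutionIVP_doublePrim {f : ℝ → ℝ} (hf : Continuous f) {e : ℝ} (h0 : 0 ≤ e) (h1 : e < 1)
    (η : ℝ) : IsSolutionIVP (fun _ t => f (kepler t e)) 0 η
      fun t => doublePrim f e η (kepler t e) := by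
  have c1 : Continuous fun σ => (1 - e * Real.cos σ) * f σ := by fun_prop
  have d1 : ∀ s, HasDerivAt (fun s => ∫ σ in (0 : ℝ)..s, (1 - e * Real.cos σ) * f σ)
      ((1 - e * Real.cos s) * f s) s := fun s => (c1.integral_hasStrictDerivAt 0 s).hasDerivAt
  have c2 : Continuous fun s => ∫ σ in (0 : ℝ)..s, (1 - e * Real.cos σ) * f σ :=
    continuous_iff_continuousAt.2 fun s => (d1 s).continuousAt
  have c3 : Continuous fun s => (1 - e * Real.cos s)
      * (η - ∫ σ in (0 : ℝ)..s, (1 - e * Real.cos σ) * f σ) := by fun_prop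
  have d2 : ∀ u, HasDerivAt (doublePrim f e η) _ u := fun u =>
    (c3.integral_hasStrictDerivAt 0 u).hasDerivAt
  have hk : kepler 0 e = 0 := kepler_unique h0 h1 (by simp)
  have h := IsSolutionIVP.of_hasDerivAt (g := fun _ t => f (kepler t e))
    (x := fun t => doublePrim f e η (kepler t e))
    (y := fun t => η - ∫ σ in (0 : ℝ)..kepler t e, (1 - e * Real.cos σ) * f σ)
    (fun t => by
      convert! (d2 (kepler t e)).comp t (hasDerivAt_kepler h0 h1 t) using 1
      have := one_sub_mul_cos_pos h0 h1 (kepler t e)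
      field_simp)
    (fun t => by
      convert! ((d1 (kepler t e)).comp t (hasDerivAt_kepler h0 h1 t)).const_sub η using 1
      have := one_sub_mul_cos_pos h0 h1 (kepler t e)
      field_simp)
  simpa [hk, doublePrim] using h

theorem isSolutionIVP_doublePrim_zero {f : ℝ → ℝ} (hf : Continuous f) (η : ℝ) :
    IsSolutionIVP (fun _ t => f t) 0 η (doublePrim f 0 η) := by
  simpa only [kepler_zero_right] using isSolutionIVP_doublePrim hf le_rfl one_pos η

/-- The Kepler function fixes 0 and mπ for every e, so the interval of the boundary value problem
does not move with e. -/
theorem kepler_mem_Icc {e : ℝ} (h0 : 0 ≤ e) (h1 : e < 1) {m : ℕ} {t : ℝ}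
    (ht : t ∈ Icc 0 (m * Real.pi)) : kepler t e ∈ Icc 0 (m * Real.pi) := by
  have hmono := kepler_strictMono h0 h1
  have hs := kepler_spec h0 h1 t
  constructor
  · rw [← hmono.le_iff_le]
    simp only [Real.sin_zero, mul_zero, sub_zero, hs]
    exact ht.1
  · rw [← hmono.le_iff_le]
    simp only [Real.sin_nat_mul_pi, mul_zero, sub_zero, hs]
    exact ht.2

/-- The boundary value problem with the unknowns `y` (the position), `w` (the inverse distance)
and `η` (the initial velocity). -/
def bvp (p : ℝ × (C(Icc (0 : ℝ) L, ℝ) × C(Icc (0 : ℝ) L, ℝ) × ℝ)) :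
    C(Icc (0 : ℝ) L, ℝ) × C(Icc (0 : ℝ) L, ℝ) × ℝ :=
  (p.2.1 - prim hL (weight L p.1 * (p.2.2.2 • (1 : C(Icc (0 : ℝ) L, ℝ))
      - prim hL (weight L p.1 * (p.2.1 * p.2.2.1 ^ 3)))),
    p.2.2.1 ^ 2 * (p.2.1 ^ 2 + (1 / 4 : ℝ) • weight L p.1 ^ 2) - 1,
    ContinuousMap.evalCLM ℝ (⟨L, hL, le_rfl⟩ : Icc (0 : ℝ) L) p.2.1)

/-- The map is polynomial: the unknown w with w²(y² + r²) = 1, where r = (1 - e cos u)/2, removes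
the root, and the eccentric anomaly removes the Kepler function. -/
theorem contDiff_bvp : ContDiff ℝ ω (bvp hL) := by
  have hw : ContDiff ℝ ω fun p : ℝ × (C(Icc (0 : ℝ) L, ℝ) × C(Icc (0 : ℝ) L, ℝ) × ℝ) =>
      weight L p.1 := by
    unfold weight
    fun_prop
  unfold bvp
  fun_prop

/-- The direction has no e-component, so the weight stays 1 along the line on which the derivative
is computed. -/
theorem fderiv_bvp_apply (y w : C(Icc (0 : ℝ) L, ℝ)) (η : ℝ) (a b : C(Icc (0 : ℝ) L, ℝ)) (β : ℝ) :
    fderiv ℝ (bvp hL) (0, y, w, η) (0, a, b, β)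
      = (a - prim hL (β • (1 : C(Icc (0 : ℝ) L, ℝ)) - prim hL (a * w ^ 3 + y * (3 * w ^ 2 * b))),
        2 * w * b * (y ^ 2 + (1 / 4 : ℝ) • 1) + w ^ 2 * (2 * y * a), a ⟨L, hL, le_rfl⟩) := by
  have h1 := (((contDiff_bvp hL).differentiable (by simp)) (0, y, w, η)).hasFDerivAt.hasLineDerivAt
    (0, a, b, β)
  refine HasDerivAt.unique h1 ?_
  have hY : HasDerivAt (fun s : ℝ => y + s • a) a 0 := by
    simpa using ((hasDerivAt_id (0 : ℝ)).smul_const a).const_add y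
  have hW : HasDerivAt (fun s : ℝ => w + s • b) b 0 := by
    simpa using ((hasDerivAt_id (0 : ℝ)).smul_const b).const_add w
  have hE : HasDerivAt (fun s : ℝ => (η + s * β) • (1 : C(Icc (0 : ℝ) L, ℝ)))
      (β • (1 : C(Icc (0 : ℝ) L, ℝ))) 0 := by
    have : HasDerivAt (fun s : ℝ => η + s * β) β 0 := by
      simpa using ((hasDerivAt_id (0 : ℝ)).mul_const β).const_add η
    exact this.smul_const (1 : C(Icc (0 : ℝ) L, ℝ))
  have k1 := hY.sub ((prim hL).hasFDerivAt.comp_hasDerivAt (0 : ℝ)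
    (hE.sub ((prim hL).hasFDerivAt.comp_hasDerivAt (0 : ℝ) (hY.mul (hW.pow 3)))))
  have k2 := ((hW.pow 2).mul ((hY.pow 2).add_const ((1 / 4 : ℝ) • 1))).sub_const 1
  have k3 := (ContinuousMap.evalCLM ℝ (⟨L, hL, le_rfl⟩ : Icc (0 : ℝ) L)).hasFDerivAt.comp_hasDerivAt
    (0 : ℝ) hY
  have k := k1.prodMk (k2.prodMk k3)
  convert! k using 1
  · funext s
    simp [bvp, weight_zero]
  · simp

end Prim

/-! ### Invertibility of the linearized boundary value problem -/

section Bvp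

variable {L η : ℝ} (hL : 0 ≤ L) {x ψ : ℝ → ℝ}

/-- The equations need to agree only along the second solution, so a fixed-point relation for a
double primitive can be compared with the differential equation. -/
theorem IsSolutionIVP.eqOn_of_abs_sub_le {g h : ℝ → ℝ → ℝ} {K T a v : ℝ} {x y : ℝ → ℝ}
    (hL : ∀ t x y, |g x t - g y t| ≤ K * |x - y|)
    (hx : IsSolutionIVP g a v x) (hy : IsSolutionIVP h a v y)
    (hgh : ∀ t ∈ Icc 0 T, g (y t) t = h (y t) t) : ∀ t ∈ Icc 0 T, x t = y t := by
  intro t ht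
  have hL' : ∀ t x y, |g x t - g y t| ≤ max 1 K * |x - y| := fun t x y =>
    (hL t x y).trans (by gcongr; exact le_max_right _ _)
  have := (hx.abs_sub_le (δ := 0) (le_max_left 1 K) hL' hy le_rfl
    (fun t ht => by rw [hgh t ht, sub_self, abs_zero]) (by simp) (by simp) t ht).1
  rw [add_zero, zero_mul] at this
  linarith [abs_nonpos_iff.1 this]

/-- The first equation says that a = βψ, and then a(L) = 0 forces β = 0. -/
theorem linearized_bvp_injective
    (hψ : IsSolutionIVP (fun y t => stiffness (x t) (1 / 2) * y) 0 1 ψ) (hne : ψ L ≠ 0)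
    {a : C(Icc (0 : ℝ) L, ℝ)} {β : ℝ} {q : C(Icc (0 : ℝ) L, ℝ)}
    (hq : ∀ t : Icc (0 : ℝ) L, q t = stiffness (x t) (1 / 2))
    (h : a - prim hL (β • (1 : C(Icc (0 : ℝ) L, ℝ)) - prim hL (q * a)) = 0)
    (haL : a ⟨L, hL, le_rfl⟩ = 0) : a = 0 ∧ β = 0 := by
  have h1 : ∀ t : Icc (0 : ℝ) L, a t = doublePrim (extendIcc hL (q * a)) 0 β t := fun t => by
    rw [← prim_prim_apply, weight_zero, one_mul, one_mul, ← sub_eq_zero.1 h]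
  have h2 := isSolutionIVP_doublePrim_zero (continuous_extendIcc hL (q * a)) β
  have h3 := hψ.linear_comb hψ β 0
  simp only [mul_zero, mul_one, zero_mul, add_zero] at h3
  have h4 := h3.eqOn_of_abs_sub_le (T := L)
    (abs_mul_sub_mul_le fun t => abs_stiffness_le (by norm_num)) h2 (fun t ht => by
      rw [extendIcc_of_mem hL _ ht, ContinuousMap.mul_apply, hq, h1])
  have hβ : β = 0 := by
    have h5 := h4 L ⟨hL, le_rfl⟩
    rw [← h1 ⟨L, hL, le_rfl⟩, haL] at h5
    exact (mul_eq_zero.1 h5).resolve_right hne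
  refine ⟨?_, hβ⟩
  ext t
  rw [h1 t, ← h4 t t.2, hβ, zero_mul]
  rfl

/-- For z = a - f the problem is z'' + qz = -(qf + g) with z(0) = 0 and z'(0) = β; as ψ(L) ≠ 0, β
can be adjusted to the prescribed end value. -/
theorem linearized_bvp_surjective
    (hx : IsSolutionIVP (fun x t => F x t 0) 0 η x)
    (hψ : IsSolutionIVP (fun y t => stiffness (x t) (1 / 2) * y) 0 1 ψ) (hne : ψ L ≠ 0)
    {q : C(Icc (0 : ℝ) L, ℝ)} (hq : ∀ t : Icc (0 : ℝ) L, q t = stiffness (x t) (1 / 2))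
    (f g : C(Icc (0 : ℝ) L, ℝ)) (c : ℝ) : ∃ (a : C(Icc (0 : ℝ) L, ℝ)) (β : ℝ),
      a - prim hL (β • (1 : C(Icc (0 : ℝ) L, ℝ)) - prim hL (q * a + g)) = f ∧
      a ⟨L, hL, le_rfl⟩ = c := by
  have cq : Continuous fun t => stiffness (x t) (1 / 2) :=
    continuous_stiffness_comp hx.continuous continuous_const fun _ => by norm_num
  obtain ⟨z₀, hz₀⟩ := exists_solution_linear (q := fun t => stiffness (x t) (1 / 2))
    (f := extendIcc hL (q * f + g)) (C := 256) (D := ‖q * f + g‖) cq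
    (fun t => abs_stiffness_le (by norm_num)) (continuous_extendIcc hL (q * f + g))
    (abs_extendIcc_le hL _) 0 0
  set β := (c - f ⟨L, hL, le_rfl⟩ - z₀ L) / ψ L with hβ
  have hz : IsSolutionIVP (fun y t => stiffness (x t) (1 / 2) * y + extendIcc hL (q * f + g) t) 0 β
      fun t => z₀ t + β * ψ t := by
    have h := IsSolutionIVP.of_hasDerivAt
      (g := fun y t => stiffness (x t) (1 / 2) * y + extendIcc hL (q * f + g) t)
      (x := fun t => z₀ t + β * ψ t) (y := fun t => deriv z₀ t + β * deriv ψ t)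
      (fun t => (hz₀.hasDerivAt t).add ((hψ.hasDerivAt t).const_mul β))
      (fun t => by
        convert! (hz₀.equation t).add ((hψ.equation t).const_mul β) using 1
        ring)
    simpa [hz₀.init_pos, hz₀.init_vel, hψ.init_pos, hψ.init_vel] using h
  let zc : C(Icc (0 : ℝ) L, ℝ) := ⟨fun t => z₀ t + β * ψ t,
    hz.continuous.comp continuous_subtype_val⟩
  have hzc : ∀ t : Icc (0 : ℝ) L, zc t = z₀ t + β * ψ t := fun t => rfl
  refine ⟨f + zc, β, ?_, ?_⟩
  · have h2 := isSolutionIVP_doublePrim_zero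
      (continuous_extendIcc hL (q * (f + zc) + g)) β
    have h4 := h2.eqOn_of_abs_sub_le (T := L) (K := 0) (by simp) hz (fun t ht => by
      rw [extendIcc_of_mem hL _ ht, extendIcc_of_mem hL _ ht]
      simp only [ContinuousMap.add_apply, ContinuousMap.mul_apply, hq, hzc]
      ring)
    ext t
    have h5 := prim_prim_apply hL (q * (f + zc) + g) 0 β t
    rw [weight_zero, one_mul, one_mul, h4 t t.2] at h5
    rw [ContinuousMap.sub_apply, h5, ContinuousMap.add_apply, hzc]
    ring
  · rw [ContinuousMap.add_apply, hzc, hβ]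
    field_simp
    ring

theorem isInvertible_fderiv_bvp
    (hx : IsSolutionIVP (fun x t => F x t 0) 0 η x)
    (hψ : IsSolutionIVP (fun y t => stiffness (x t) (1 / 2) * y) 0 1 ψ) (hne : ψ L ≠ 0)
    {y w : C(Icc (0 : ℝ) L, ℝ)} (hy : ∀ t : Icc (0 : ℝ) L, y t = x t)
    (hw : ∀ t : Icc (0 : ℝ) L, w t = invDist (x t) (1 / 2)) :
    (fderiv ℝ (bvp hL) (0, y, w, η) ∘L .inr ℝ ℝ
      (C(Icc (0 : ℝ) L, ℝ) × C(Icc (0 : ℝ) L, ℝ) × ℝ)).IsInvertible := by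
  set D := fderiv ℝ (bvp hL) (0, y, w, η) ∘L .inr ℝ ℝ
    (C(Icc (0 : ℝ) L, ℝ) × C(Icc (0 : ℝ) L, ℝ) × ℝ) with hDdef
  set q : C(Icc (0 : ℝ) L, ℝ) := w ^ 3 - 3 * y ^ 2 * w ^ 5 with hqdef
  have hq : ∀ t : Icc (0 : ℝ) L, q t = stiffness (x t) (1 / 2) := fun t => by
    rw [stiffness, ← hw, ← hy]
    rfl
  have hww : w ^ 2 * (y ^ 2 + (1 / 4 : ℝ) • 1) = 1 := by
    ext t
    have := invDist_sq_mul (x := x t) (ρ := 1 / 2) (by norm_num)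
    rw [← hw, ← hy] at this
    simp only [ContinuousMap.mul_apply, ContinuousMap.add_apply, ContinuousMap.pow_apply,
      ContinuousMap.smul_apply, ContinuousMap.one_apply, smul_eq_mul]
    linarith
  have hD : ∀ a b β, D (a, b, β)
      = (a - prim hL (β • (1 : C(Icc (0 : ℝ) L, ℝ)) - prim hL (a * w ^ 3 + y * (3 * w ^ 2 * b))),
        2 * w * b * (y ^ 2 + (1 / 4 : ℝ) • 1) + w ^ 2 * (2 * y * a), a ⟨L, hL, le_rfl⟩) :=
    fun a b β => fderiv_bvp_apply hL y w η a b β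
  have hker : D.ker = ⊥ := by
    refine LinearMap.ker_eq_bot'.2 ?_
    rintro ⟨a, b, β⟩ h
    have h' : D (a, b, β) = 0 := h
    rw [hD, Prod.mk_eq_zero, Prod.mk_eq_zero] at h'
    obtain ⟨h1, h2, h3⟩ := h'
    -- Multiplication by w and w²(y² + 1/4) = 1 solve the second component for b; substituting b in
    -- the first produces the potential q.
    have hb2 : (2 : C(Icc (0 : ℝ) L, ℝ)) * (b + w ^ 3 * y * a) = 0 := by
      linear_combination w * h2 - 2 * b * hww
    have hb : b = -(w ^ 3 * y * a) := by
      ext t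
      have := DFunLike.congr_fun hb2 t
      have h2 : (2 : C(Icc (0 : ℝ) L, ℝ)) t = 2 := rfl
      simp only [ContinuousMap.mul_apply, ContinuousMap.add_apply, ContinuousMap.zero_apply,
        ContinuousMap.neg_apply, h2] at this ⊢
      linarith
    have he : a * w ^ 3 + y * (3 * w ^ 2 * b) = q * a := by
      rw [hb, hqdef]
      ring
    rw [he] at h1
    obtain ⟨ha, hβ⟩ := linearized_bvp_injective hL hψ hne hq h1 h3
    rw [ha, mul_zero, neg_zero] at hb
    rw [ha, hb, hβ]
    rfl
  have hrange : D.range = ⊤ := by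
    refine LinearMap.range_eq_top.2 ?_
    rintro ⟨f, g, c⟩
    -- With right-hand side g the same elimination gives b = wg/2 - w³ya, and 3yw² · wg/2 is the
    -- source term.
    obtain ⟨a, β, h1, h2⟩ := linearized_bvp_surjective hL hx hψ hne hq f
      ((3 / 2 : ℝ) • (y * w ^ 3 * g)) c
    refine ⟨(a, (1 / 2 : ℝ) • (w * g) - w ^ 3 * y * a, β), ?_⟩
    change D _ = _
    rw [hD]
    have e1 : a * w ^ 3 + y * (3 * w ^ 2 * ((1 / 2 : ℝ) • (w * g) - w ^ 3 * y * a))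
        = q * a + (3 / 2 : ℝ) • (y * w ^ 3 * g) := by
      ext t
      have h3 : (3 : C(Icc (0 : ℝ) L, ℝ)) t = 3 := rfl
      simp only [hqdef, ContinuousMap.mul_apply, ContinuousMap.add_apply, ContinuousMap.sub_apply,
        ContinuousMap.pow_apply, ContinuousMap.smul_apply, smul_eq_mul, h3]
      ring
    have e2 : 2 * w * ((1 / 2 : ℝ) • (w * g) - w ^ 3 * y * a) * (y ^ 2 + (1 / 4 : ℝ) • 1)
        + w ^ 2 * (2 * y * a) = g := by
      ext t
      have h3 : (2 : C(Icc (0 : ℝ) L, ℝ)) t = 2 := rfl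
      have h4 := DFunLike.congr_fun hww t
      simp only [ContinuousMap.mul_apply, ContinuousMap.add_apply, ContinuousMap.sub_apply,
        ContinuousMap.pow_apply, ContinuousMap.smul_apply, smul_eq_mul, h3,
        ContinuousMap.one_apply] at h4 ⊢
      linear_combination (g t - 2 * (w t) ^ 2 * y t * a t) * h4
    rw [e1, e2, h1, h2]
  exact ⟨ContinuousLinearEquiv.ofBijective D hker hrange,
    ContinuousLinearEquiv.coe_ofBijective D hker hrange⟩

end Bvp

/-! ### Continuation in the eccentricity by the implicit function theorem -/

/-- The zeros of the boundary value problem are the solutions of the Sitnikov problem that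
vanish at time `mπ`. -/
theorem eq_zero_of_bvp_eq_zero {m : ℕ} (hL : 0 ≤ m * Real.pi) {e η : ℝ} (h0 : 0 ≤ e)
    (h1 : e ≤ 1 / 2) {y w : C(Icc (0 : ℝ) (m * Real.pi), ℝ)} (hw : ∀ t, 0 < w t)
    (h : bvp hL (e, y, w, η) = 0) {X : ℝ → ℝ}
    (hX : IsSolutionIVP (fun x t => F x t e) 0 η X) : X (m * Real.pi) = 0 := by
  have he1 : e < 1 := by linarith
  rw [bvp, Prod.mk_eq_zero, Prod.mk_eq_zero] at h
  obtain ⟨hy, hww, hyL⟩ := h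
  simp only at hy hww hyL
  have hy' : ∀ u : Icc (0 : ℝ) (m * Real.pi),
      y u = doublePrim (extendIcc hL (y * w ^ 3)) e η u := fun u => by
    rw [← prim_prim_apply]
    exact DFunLike.congr_fun (sub_eq_zero.1 hy) u
  have hsol := isSolutionIVP_doublePrim (continuous_extendIcc hL (y * w ^ 3)) h0 he1 η
  have heq := hX.eqOn_of_abs_sub_le (T := m * Real.pi) (abs_F_sub_le h0 h1) hsol (fun t ht => by
    have hk := kepler_mem_Icc h0 he1 ht
    rw [extendIcc_of_mem hL _ hk, ← hy' ⟨_, hk⟩, F_eq]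
    have : invDist (y ⟨_, hk⟩) (r t e) = w ⟨_, hk⟩ := by
      refine invDist_eq_of_sq_mul (hw _) ?_
      have h2 := DFunLike.congr_fun hww ⟨_, hk⟩
      simp only [ContinuousMap.mul_apply, ContinuousMap.add_apply, ContinuousMap.sub_apply,
        ContinuousMap.pow_apply, ContinuousMap.smul_apply, smul_eq_mul, ContinuousMap.one_apply,
        weight_apply, ContinuousMap.zero_apply] at h2
      rw [r]
      linarith
    rw [this]
    rfl) (m * Real.pi) ⟨hL, le_rfl⟩
  have hk : kepler (m * Real.pi) e = m * Real.pi := kepler_unique h0 he1 (by simp)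
  rw [heq, hk, ← hy' ⟨_, hL, le_rfl⟩]
  exact hyL

/-- Continuation of a nondegenerate odd periodic solution of the circular problem to small
eccentricities. -/
theorem exists_smooth_velocity {m : ℕ} {η : ℝ} {x ψ : ℝ → ℝ}
    (hx : IsSolutionIVP (fun x t => F x t 0) 0 η x) (hxm : x (m * Real.pi) = 0)
    (hψ : IsSolutionIVP (fun y t => stiffness (x t) (1 / 2) * y) 0 1 ψ)
    (hne : ψ (m * Real.pi) ≠ 0) :
    ∃ (δ : ℝ) (E : ℝ → ℝ), 0 < δ ∧ δ ≤ 1 / 2 ∧ ContDiffOn ℝ ∞ E (Ico 0 δ) ∧ E 0 = η ∧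
      ∀ e ∈ Ico 0 δ, ∀ X, IsSolutionIVP (fun x t => F x t e) 0 (E e) X →
        X (m * Real.pi) = 0 := by
  have hL : 0 ≤ m * Real.pi := by positivity
  have cx := hx.continuous
  have cw : Continuous fun t => invDist (x t) (1 / 2) :=
    continuous_invDist_comp cx continuous_const fun _ => by norm_num
  let y₀ : C(Icc (0 : ℝ) (m * Real.pi), ℝ) := ⟨fun t => x t, by fun_prop⟩
  let w₀ : C(Icc (0 : ℝ) (m * Real.pi), ℝ) := ⟨fun t => invDist (x t) (1 / 2),
    cw.comp continuous_subtype_val⟩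
  have hy₀ : ∀ t : Icc (0 : ℝ) (m * Real.pi), y₀ t = x t := fun t => rfl
  have hw₀ : ∀ t : Icc (0 : ℝ) (m * Real.pi), w₀ t = invDist (x t) (1 / 2) := fun t => rfl
  have hbase : bvp hL (0, y₀, w₀, η) = 0 := by
    rw [bvp, Prod.mk_eq_zero, Prod.mk_eq_zero]
    refine ⟨?_, ?_, hxm⟩
    · have h2 := isSolutionIVP_doublePrim_zero
        (continuous_extendIcc hL (y₀ * w₀ ^ 3)) η
      have h4 := h2.eqOn_of_abs_sub_le (T := m * Real.pi) (K := 0) (by simp) hx (fun t ht => by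
        rw [extendIcc_of_mem hL _ ht, F_zero_right]
        rfl)
      ext t
      simp only [ContinuousMap.sub_apply]
      rw [prim_prim_apply hL (y₀ * w₀ ^ 3) 0 η t, h4 t t.2, hy₀]
      simp
    · ext t
      have := invDist_sq_mul (x := x t) (ρ := 1 / 2) (by norm_num)
      simp only [weight_zero, ContinuousMap.mul_apply, ContinuousMap.add_apply,
        ContinuousMap.sub_apply, ContinuousMap.pow_apply, ContinuousMap.smul_apply, smul_eq_mul,
        ContinuousMap.one_apply, ContinuousMap.zero_apply, hy₀, hw₀]
      linarith
  have cdf : ContDiffAt ℝ ω (bvp hL) (0, y₀, w₀, η) := (contDiff_bvp hL).contDiffAt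
  have hinv := isInvertible_fderiv_bvp hL hx hψ hne hy₀ hw₀
  set Ψ := cdf.implicitFunction (by simp) hinv with hΨ
  have hΨ0 : Ψ 0 = (y₀, w₀, η) := cdf.implicitFunction_apply_self (by simp) hinv
  have hΨs : ContDiffAt ℝ ω Ψ 0 := cdf.contDiffAt_implicitFunction (by simp) hinv
  have hΨe : ∀ᶠ e in nhds (0 : ℝ), bvp hL (e, Ψ e) = 0 := by
    have := cdf.eventually_apply_implicitFunction (by simp) hinv
    rwa [hbase] at this
  have hsm : ∀ᶠ e in nhds (0 : ℝ), ContDiffAt ℝ ω Ψ e := hΨs.eventually (by simp)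
  -- Needed to single out the correct root of w²(y² + r²) = 1; w₀ has a positive minimum and Ψ is
  -- continuous in the uniform norm.
  have hwpos : ∀ᶠ e in nhds (0 : ℝ), ∀ t, 0 < (Ψ e).2.1 t := by
    have hc : ContinuousAt (fun e => (Ψ e).2.1) 0 :=
      hΨs.continuousAt.snd.fst
    obtain ⟨t₀, -, ht₀⟩ := isCompact_Icc.exists_isMinOn (nonempty_Icc.2 hL) cw.continuousOn
    have hb := Metric.continuousAt_iff'.1 hc (invDist (x t₀) (1 / 2)) (invDist_pos (by norm_num))
    filter_upwards [hb] with e he t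
    have h1 := ((Ψ e).2.1 - w₀).norm_coe_le_norm t
    have h2 := isMinOn_iff.1 ht₀ t t.2
    rw [hΨ0, dist_eq_norm] at he
    rw [ContinuousMap.sub_apply, hw₀, Real.norm_eq_abs] at h1
    simp only at he
    linarith [(abs_le.1 h1).1]
  obtain ⟨δ, hδ, hall⟩ := Metric.eventually_nhds_iff.1 (hΨe.and (hsm.and hwpos))
  have hmem : ∀ e ∈ Ico 0 (min δ (1 / 2)), dist e 0 < δ := fun e he => by
    rw [Real.dist_eq, sub_zero, abs_of_nonneg he.1]
    exact he.2.trans_le (min_le_left _ _)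
  refine ⟨min δ (1 / 2), fun e => (Ψ e).2.2, by positivity, min_le_right _ _, fun e he => ?_,
    congrArg (fun z => z.2.2) hΨ0, fun e he X hX => ?_⟩
  · have := (hall (hmem e he)).2.1
    exact (this.snd.snd.of_le le_top).contDiffWithinAt
  · obtain ⟨h1, -, h3⟩ := hall (hmem e he)
    exact eq_zero_of_bvp_eq_zero hL he.1 (he.2.le.trans (min_le_right _ _)) h3 h1 hX

/-! ### The theorem -/

theorem exists_oddFamily {m p : ℕ} (hm : m ≠ 0) (hp : p ≠ 0) (hpm : (p : ℝ) < Real.sqrt 8 * m) :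
    ∃ (ε : ℝ) (E : ℝ → ℝ) (φ : ℝ → ℝ → ℝ) (τ : ℝ → ℝ),
      IsOddFamily m p ε E φ ∧ IsTraceAlong m ε φ τ := by
  have hm' : (0 : ℝ) < m := by positivity
  have hp' : (0 : ℝ) < p := by positivity
  have hpi := Real.pi_pos
  set σ : ℝ := m * Real.pi / (2 * p) with hσdef
  have hσ : 0 < σ := by positivity
  -- As π/(2σ) = p/m, this is the condition p < √8 m.
  have hσ8 : (Real.pi / (2 * σ)) ^ 2 < 8 := by
    have h1 : Real.pi / (2 * σ) = p / m := by rw [hσdef]; field_simp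
    rw [h1, div_pow, div_lt_iff₀ (by positivity)]
    have h2 : (Real.sqrt 8 * m) ^ 2 = 8 * (m : ℝ) ^ 2 := by
      rw [mul_pow, Real.sq_sqrt (by norm_num)]
    rw [← h2]
    gcongr
  obtain ⟨η, x, hη, hx, hturn, hpos⟩ := exists_quarter_solution hσ hσ8
  have hS := hx.antiperiodic_of_deriv_eq_zero hturn
  have hpos' := hx.pos_on_half_period hturn hpos
  have hS0 : 0 < 2 * σ := by positivity
  have hpS : (p : ℝ) * (2 * σ) = m * Real.pi := by rw [hσdef]; field_simp
  have hmin := hx.isMinimalPeriod hη hS0 hS hpos'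
  have hxk : ∀ k : ℕ, x (k * (2 * σ)) = 0 := fun k => by
    induction k with
    | zero => simp [hx.init_pos]
    | succ k ih =>
      rw [show ((k + 1 : ℕ) : ℝ) * (2 * σ) = k * (2 * σ) + 2 * σ by push_cast; ring, hS, ih,
        neg_zero]
  have hxm : x (m * Real.pi) = 0 := by rw [← hpS, hxk]
  obtain ⟨ψ, hψ⟩ := exists_solution_linear (q := fun t => stiffness (x t) (1 / 2))
    (f := fun _ => 0) (C := 256) (D := 0)
    (continuous_stiffness_comp hx.continuous continuous_const fun _ => by norm_num)
    (fun t => abs_stiffness_le (by norm_num)) continuous_const (by simp) 0 1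
  simp only [add_zero] at hψ
  have hne := linearized_ne_zero hx hη hS0 hS hpos' hψ hp
  rw [hpS] at hne
  obtain ⟨ε, E, hε, hεh, hE, hE0, hbd⟩ := exists_smooth_velocity hx hxm hψ hne
  have hsol : ∀ e ∈ Ico 0 ε, ∃ X, IsSolutionIVP (fun x t => F x t e) 0 (E e) X := fun e he =>
    exists_solution_F he.1 (he.2.le.trans hεh) _
  choose! X hX using hsol
  have hX0 : X 0 = x := (hX 0 ⟨le_rfl, hε⟩).ext_of_eq_at (abs_F_sub_le le_rfl (by norm_num)) hx
    (t₀ := 0) (by rw [(hX 0 ⟨le_rfl, hε⟩).init_pos, hx.init_pos])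
    (by rw [(hX 0 ⟨le_rfl, hε⟩).init_vel, hx.init_vel, hE0])
  have htrace : ∀ e ∈ Ico 0 ε, ∃ τ, IsHillTrace (potential (fun t e => X e t) e)
      (2 * m * Real.pi) τ := fun e he => by
    have heh := he.2.le.trans hεh
    have hr := one_fourth_le_r he.1 heh
    have hpot : potential (fun t e => X e t) e = fun t => stiffness (X e t) (r t e) :=
      funext (potential_eq he.1 heh)
    have hlin : ∀ a v, ∃ y, IsSolutionIVP (fun y t => stiffness (X e t) (r t e) * y) a v y := by
      intro a v
      simpa only [add_zero] using exists_solution_linear (C := 256) (D := 0)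
        (continuous_stiffness_comp (hX e he).continuous (continuous_r he.1 (by linarith))
          fun t => by linarith [hr t])
        (fun t => abs_stiffness_le (hr t)) (continuous_const (y := (0 : ℝ))) (by simp) a v
    obtain ⟨ψ₁, h1⟩ := hlin 1 0
    obtain ⟨ψ₂, h2⟩ := hlin 0 1
    rw [hpot]
    exact ⟨_, ψ₁, ψ₂, h1, h2, rfl⟩
  choose! τ hτ using htrace
  refine ⟨ε, E, fun t e => X e t, τ, ⟨hε, by linarith, hE, hX,
    fun e he => hbd e he _ (hX e he), by rwa [hE0], ?_⟩, hτ⟩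
  rw [hX0]
  convert! hmin using 1
  rw [hσdef]
  field_simp

end

end Sitnikov

theorem theorem4p1 (m p : ℕ) (hp : 1 ≤ p) (hpm : p ≤ ⌊Real.sqrt 8 * (m : ℝ)⌋₊) :
    (∃ (ε : ℝ) (E : ℝ → ℝ) (φ : ℝ → ℝ → ℝ) (τ : ℝ → ℝ),
      Sitnikov.IsOddFamily m p ε E φ ∧ Sitnikov.IsTraceAlong m ε φ τ) ∧
    ((∀ n : ℕ, 1 ≤ n → (p : ℝ) / (m : ℝ) ≠ 1 / (2 * (n : ℝ))) →
      Sitnikov.TraceDerivVanishes m p) ∧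
    (Odd m → Sitnikov.TraceDerivVanishes m p) ∧
    (Even m → m / 2 + 1 ≤ p → Sitnikov.TraceDerivVanishes m p) := by
  have hm : m ≠ 0 := by
    rintro rfl
    simp at hpm
    omega
  have hp0 : p ≠ 0 := by omega
  have hle : (p : ℝ) ≤ Real.sqrt 8 * m := (Nat.le_floor_iff (by positivity)).1 hpm
  -- Shooting needs strict inequality; equality would make √2 = p/(2m) rational.
  have hlt : (p : ℝ) < Real.sqrt 8 * m := by
    refine lt_of_le_of_ne hle fun heq => ?_
    refine irrational_sqrt_two ⟨(p : ℚ) / (2 * m), ?_⟩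
    push_cast
    have hm' : (0 : ℝ) < m := by positivity
    have h8 : Real.sqrt 8 = 2 * Real.sqrt 2 := by
      rw [show (8 : ℝ) = 2 ^ 2 * 2 by norm_num, Real.sqrt_mul (by norm_num),
        Real.sqrt_sq (by norm_num)]
    rw [heq, h8]
    field_simp
  -- An exceptional ratio means m = 2np, so that m is even and p ≤ m/2.
  have hratio : ∀ n : ℕ, 1 ≤ n → (p : ℝ) / (m : ℝ) = 1 / (2 * (n : ℝ)) → m = 2 * n * p := by
    intro n hn h
    have hm' : (m : ℝ) ≠ 0 := by exact_mod_cast hm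
    have hn' : (n : ℝ) ≠ 0 := by
      have : n ≠ 0 := by omega
      exact_mod_cast this
    rw [div_eq_div_iff hm' (by positivity)] at h
    have : (m : ℝ) = 2 * n * p := by linarith
    exact_mod_cast this
  have hgen := Sitnikov.traceDerivVanishes_of_ratio_ne hm hp0
  refine ⟨Sitnikov.exists_oddFamily hm hp0 hlt, hgen, fun hodd => hgen fun n hn h => ?_,
    fun _ hmp => hgen fun n hn h => ?_⟩
  · have h1 := hratio n hn h
    rw [mul_assoc] at h1
    exact (Nat.not_even_iff_odd.2 hodd) (h1 ▸ even_two_mul _)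
  · have h1 := hratio n hn h
    have h2 : p ≤ n * p := Nat.le_mul_of_pos_left p hn
    rw [mul_assoc] at h1
    omega
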